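/- **Setting.** Let $d,n_{\mathrm r},T\ge 1$, let $F(\cdot;\xi):\mathbb R^d\to\mathbb R$ be loss functions, jointly measurable in $(x,\xi)$, with $\xi$ drawn from a probability distribution, and suppose that $f(x)=\mathbb E_\xi F(x;\xi)$ is well defined and bounded below, $f^*=\inf f$. Assume: 1. ($L$-smoothness) every $F(\cdot;\xi)$ is differentiable with $\|\nabla F(x;\xi)-\nabla F(y;\xi)\|\le L\|x-y\|$ for all $x,y$, where $L>0$; 2. (coordinate-wise variance) $\mathbb E_\xi[(\nabla F(x;\xi)-\nabla f(x))_i^2]\le\zeta^2$ for all $x$ and $i$; put $\sigma^2=d\zeta^2$, $\sigma>0$. **Algorithm (ZO-HGD).** Start from $x_0\in\mathbb R^d$. At step $t=0,\dots,T-1$, draw independent mini-batches $\mathcal B_t^{\mathrm r},\mathcal B_t^{\mathrm c}$ (of any sizes $\ge 1$) of i.i.d. samples $\xi$ and, for every $\xi\in\mathcal B_t^{\mathrm r}$, i.i.d. directions $u_{1,\xi},\dots,u_{n_{\mathrm r},\xi}$ uniform on the unit sphere, all independent of the past. Let $$\nabla_{\mathrm r,t}=\frac1{|\mathcal B_t^{\mathrm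 r}|}\sum_{\xi\in\mathcal B_t^{\mathrm r}}\frac1{n_{\mathrm r}}\sum_{k=1}^{n_{\mathrm r}}\frac{d\,[F(x_t+\mu_{\mathrm r}u_{k,\xi};\xi)-F(x_t;\xi)]}{\mu_{\mathrm r}}\,u_{k,\xi}.$$ Choose selection probabilities $p_{t,1},\dots,p_{t,d}$ by any (measurable) rule from the past, the batch $\mathcal B_t^{\mathrm r}$ and its directions (for instance deterministic, or a function of $\nabla_{\mathrm r,t}$). Draw a random set $\mathcal I_t\subseteq\{1,\dots,d\}$ with $\Pr(i\in\mathcal I_t)=p_{t,i}$ for each $i$, conditionally on everything drawn so far, including $\mathcal B_t^{\mathrm c}$. Let $$\nabla_{\mathrm c,t}=\frac1{|\mathcal B_t^{\mathrm c}|}\sum_{\xi\in\mathcal B_t^{\mathrm c}}\sum_{i\in\mathcal I_t}\frac1{p_{t,i}}\,\frac{F(x_t+\mu_{\mathrm c}e_i;\xi)-F(x_t-\mu_{\mathrm c}e_i;\xi)}{2\mu_{\mathrm c}}\,e_i,\qquad x_{t+1}=x_t-\eta\,\big(\alpha\nabla_{\mathrm r,t}+(1-\alpha)\nabla_{\mathrm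 c,t}\big).$$ The output $\bar x_T$ is picked uniformly at random from $\{x_1,\dots,x_T\}$, independently of the run. Put $$d_{\mathrm{nr}}=1+\frac d{n_{\mathrm r}},\qquad \bar P_T=\mathbb E\Big[\frac1{dT}\sum_{t=0}^{T-1}\sum_{i=1}^d\frac1{p_{t,i}}\Big]$$ (the expectation is void if the $p_{t,i}$ are deterministic), and $$R=\frac{d_{\mathrm{nr}}}{1+d_{\mathrm{nr}}/\bar P_T}.$$ **Theorem.** Let $L,\sigma,a>0$ and $\Delta,K,b\in\mathbb R$. There is a constant $C$, depending only on $L,\sigma,\Delta,K,a,b$ (not on $d,n_{\mathrm r},T$, the probabilities, the batch sizes, or the problem), such that the following holds in the above setting. Suppose $f(x_0)-f^*\le\Delta$; almost surely $p_{t,i}\ge c_t$ for all $i$ and $t<T$, with constants $c_t>0$; $\mu_{\mathrm r}>0$, $\mu_{\mathrm c}=\mu_{\mathrm r}\sqrt d/2$ and $\mu_{\mathrm c}L\sqrt d\le\sigma$; $$\mu_{\mathrm c}\le K\Big(\frac{d_{\mathrm{nr}}}{d^2T}\Big)^{1/4}\Big(1+\frac{d_{\mathrm{nr}}}{\bar P_T}\Big)^{-1/4};$$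 $\alpha=[1+d_{\mathrm{nr}}/\bar P_T]^{-1}$; and the constant step size satisfies $$\eta\le\frac1{24L}\min\Big\{3c_t,\frac1{d_{\mathrm{nr}}}\Big\}\ \text{ for all } t<T$$ and is of the optimal order, $\dfrac a{\sqrt{RT}}\le\eta\le\dfrac b{\sqrt{RT}}$. Then $\|\nabla f(\bar x_T)\|^2$ is integrable and $$\mathbb E\|\nabla f(\bar x_T)\|^2\le C\sqrt{\frac{d_{\mathrm{nr}}}{T}\cdot\frac1{1+d_{\mathrm{nr}}/\bar P_T}}.$$ -/

import Mathlib

open MeasureTheory ProbabilityTheory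

namespace ZOHGD

/-- The space `ℝ^d` with the Euclidean norm. -/
abbrev Vec (d : ℕ) := EuclideanSpace ℝ (Fin d)

/-- The canonical basis vector `e_i`. -/
noncomputable abbrev basisVec {d : ℕ} (i : Fin d) : Vec d := EuclideanSpace.single i (1 : ℝ)

/-- The uniform probability distribution on the unit sphere of `ℝ^d` (for `1 ≤ d`), as a measure
on `ℝ^d`: the normalized surface measure. -/
noncomputable def sphereUnif (d : ℕ) : Measure (Vec d) :=
  ((volume : Measure (Vec d)).toSphere Set.univ)⁻¹ •
    ((volume : Measure (Vec d)).toSphere).map Subtype.val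

section Problem

variable {d : ℕ} {Ξ : Type*} [MeasurableSpace Ξ]

/-- The objective `f(x) = E_{ξ ∼ ν} F(x; ξ)`. -/
noncomputable def objective (F : Vec d → Ξ → ℝ) (ν : Measure Ξ) (x : Vec d) : ℝ :=
  ∫ ξ, F x ξ ∂ν

/-- The gradient at `x` of the loss `F(·; ξ)` of one sample. -/
noncomputable def sampleGrad (F : Vec d → Ξ → ℝ) (x : Vec d) (ξ : Ξ) : Vec d :=
  gradient (fun y => F y ξ) x

/-- The objective is well defined: `F` is measurable, and `F(x; ·)` is integrable. -/
structure WellPosed (F : Vec d → Ξ → ℝ) (ν : Measure Ξ) : Prop where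
  measurable : Measurable (Function.uncurry F)
  integrable : ∀ x, Integrable (F x) ν

/-- Gradient Lipschitz continuity, with constant `L`, of the losses `F(·; ξ)`. -/
structure LipschitzGrad (F : Vec d → Ξ → ℝ) (L : ℝ) : Prop where
  differentiable : ∀ ξ, Differentiable ℝ (fun x => F x ξ)
  lipschitz : ∀ ξ x y, ‖sampleGrad F x ξ - sampleGrad F y ξ‖ ≤ L * ‖x - y‖

/-- Coordinate-wise variance bound: `E[(∇F(x; ξ) - ∇f(x))_i ^ 2] ≤ ζ ^ 2` for all `x`, `i`. -/
structure CoordVarianceBound (F : Vec d → Ξ → ℝ) (ν : Measure Ξ) (ζ : ℝ) : Prop where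
  integrable : ∀ x i,
    Integrable (fun ξ => (sampleGrad F x ξ i - gradient (objective F ν) x i) ^ 2) ν
  bound : ∀ x i,
    ∫ ξ, (sampleGrad F x ξ i - gradient (objective F ν) x i) ^ 2 ∂ν ≤ ζ ^ 2

/-- Random gradient estimator of one sample `ξ`, with directions `u_1, …, u_n`. -/
noncomputable def rgeSample {n : ℕ} (F : Vec d → Ξ → ℝ) (μr : ℝ) (x : Vec d) (ξ : Ξ)
    (u : Fin n → Vec d) : Vec d :=
  (1 / (n : ℝ)) • ∑ k, (((d : ℝ) * (F (x + μr • u k) ξ - F x ξ)) / μr) • u k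

/-- Random gradient estimator over a mini-batch; each sample comes with its own directions. -/
noncomputable def rge {n b : ℕ} (F : Vec d → Ξ → ℝ) (μr : ℝ) (x : Vec d)
    (B : Fin b → Ξ × (Fin n → Vec d)) : Vec d :=
  (1 / (b : ℝ)) • ∑ j, rgeSample F μr x (B j).1 (B j).2

/-- The `i`-th component of the coordinate-wise gradient estimator of one sample. -/
noncomputable def cgeCoord (F : Vec d → Ξ → ℝ) (μc : ℝ) (x : Vec d) (ξ : Ξ) (i : Fin d) : Vec d :=
  ((F (x + μc • basisVec i) ξ - F (x - μc • basisVec i) ξ) / (2 * μc)) • basisVec i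

/-- Coordinate-wise gradient estimator of one sample, on the coordinate set `I` with selection
probabilities `p`. -/
noncomputable def cgeSample (F : Vec d → Ξ → ℝ) (μc : ℝ) (x : Vec d) (I : Finset (Fin d))
    (p : Fin d → ℝ) (ξ : Ξ) : Vec d :=
  ∑ i, ((if i ∈ I then 1 else 0) / p i) • cgeCoord F μc x ξ i

/-- Coordinate-wise gradient estimator over a mini-batch. -/
noncomputable def cge {b : ℕ} (F : Vec d → Ξ → ℝ) (μc : ℝ) (x : Vec d) (I : Finset (Fin d))
    (p : Fin d → ℝ) (B : Fin b → Ξ) : Vec d :=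
  (1 / (b : ℝ)) • ∑ j, cgeSample F μc x I p (B j)

/-- Hybrid gradient estimator. -/
noncomputable def hge {n br bc : ℕ} (F : Vec d → Ξ → ℝ) (μr μc α : ℝ) (x : Vec d)
    (Br : Fin br → Ξ × (Fin n → Vec d)) (Bc : Fin bc → Ξ) (I : Finset (Fin d))
    (p : Fin d → ℝ) : Vec d :=
  α • rge F μr x Br + (1 - α) • cge F μc x I p Bc

end Problem

/-- The random data that an execution of ZO-HGD draws, for samples in `Ξ`, dimension `d`, and `n`
random directions per sample, on a sample space `Ω`. -/
structure Draws (d : ℕ) (Ξ : Type*) (Ω : Type*) (n : ℕ) where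
  /-- size of the RGE mini-batch of step `t` -/
  br : ℕ → ℕ
  /-- size of the CGE mini-batch of step `t` -/
  bc : ℕ → ℕ
  /-- RGE mini-batch of step `t`: samples, each with its random directions -/
  Br : (t : ℕ) → Ω → Fin (br t) → Ξ × (Fin n → Vec d)
  /-- CGE mini-batch of step `t` -/
  Bc : (t : ℕ) → Ω → Fin (bc t) → Ξ
  /-- coordinate selection probabilities of step `t` -/
  p : ℕ → Ω → Fin d → ℝ
  /-- coordinate set of step `t` -/
  I : ℕ → Ω → Finset (Fin d)
  /-- index of the iterate that is returned -/
  τ : Ω → ℕ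

namespace Draws

variable {d n : ℕ} {Ξ Ω : Type*} [MeasurableSpace Ξ] [MeasurableSpace Ω]

/-- The σ-algebra generated by the randomness of the steps before `t`. -/
@[reducible] def history (D : Draws d Ξ Ω n) (t : ℕ) : MeasurableSpace Ω :=
  ⨆ s : ℕ, ⨆ _ : s < t,
    (MeasurableSpace.comap (D.Br s) inferInstance ⊔ MeasurableSpace.comap (D.Bc s) inferInstance
      ⊔ MeasurableSpace.comap (D.I s) ⊤)

/-- What is known when the selection probabilities of step `t` are computed: the history and the
RGE draws of step `t`. -/
@[reducible] def afterRGE (D : Draws d Ξ Ω n) (t : ℕ) : MeasurableSpace Ω :=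
  D.history t ⊔ MeasurableSpace.comap (D.Br t) inferInstance

/-- What is known when the coordinate set of step `t` is sampled: in addition, the CGE
mini-batch of step `t`. -/
@[reducible] def beforeCoord (D : Draws d Ξ Ω n) (t : ℕ) : MeasurableSpace Ω :=
  D.afterRGE t ⊔ MeasurableSpace.comap (D.Bc t) inferInstance

/-- The draws follow the sampling scheme of ZO-HGD with `T` steps and sample distribution `ν`. -/
structure IsZOHGD (D : Draws d Ξ Ω n) (ν : Measure Ξ) (P : Measure Ω) (T : ℕ) : Prop where
  br_pos : ∀ t < T, 1 ≤ D.br t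
  bc_pos : ∀ t < T, 1 ≤ D.bc t
  measurable_Br : ∀ t < T, Measurable (D.Br t)
  measurable_Bc : ∀ t < T, Measurable (D.Bc t)
  measurable_I : ∀ t < T, Measurable[_, ⊤] (D.I t)
  measurable_τ : Measurable D.τ
  /-- The samples of the RGE mini-batch are i.i.d. from `ν`, the directions are i.i.d. uniform on
  the unit sphere, and all of them are independent of each other -/
  law_Br : ∀ t < T, P.map (D.Br t) =
    Measure.pi (fun _ => ν.prod (Measure.pi (fun _ => sphereUnif d)))
  /-- and of the past. -/
  indep_Br : ∀ t < T, Indep (MeasurableSpace.comap (D.Br t) inferInstance) (D.history t) P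
  /-- The samples of the CGE mini-batch are i.i.d. from `ν` -/
  law_Bc : ∀ t < T, P.map (D.Bc t) = Measure.pi (fun _ => ν)
  /-- and independent of the past and of the RGE draws of the same step. -/
  indep_Bc : ∀ t < T, Indep (MeasurableSpace.comap (D.Bc t) inferInstance) (D.afterRGE t) P
  /-- The selection probabilities are computed from the past and the RGE draws of the step. -/
  adapted_p : ∀ t < T, Measurable[D.afterRGE t] (D.p t)
  /-- Given all that was drawn before, coordinate `i` is selected with probability `p_{t,i}`. -/
  select : ∀ t < T, ∀ i : Fin d,
    P[Set.indicator {ω | i ∈ D.I t ω} (fun _ => (1 : ℝ)) | D.beforeCoord t]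
      =ᵐ[P] fun ω => D.p t ω i
  /-- The output index is uniform on `{1, …, T}` -/
  law_τ : ∀ t, 1 ≤ t → t ≤ T → P (D.τ ⁻¹' {t}) = (T : ENNReal)⁻¹
  /-- and independent of the run. -/
  indep_τ : Indep (MeasurableSpace.comap D.τ ⊤) (D.history T) P

/-- The iterates: `x_{t+1} = x_t - η_t (α_t ∇_{r,t} + (1 - α_t) ∇_{c,t})`. -/
noncomputable def iterate (D : Draws d Ξ Ω n) (F : Vec d → Ξ → ℝ) (μr μc : ℝ) (η α : ℕ → ℝ)
    (x₀ : Vec d) : ℕ → Ω → Vec d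
  | 0, _ => x₀
  | t + 1, ω =>
      iterate D F μr μc η α x₀ t ω -
        η t • hge F μr μc (α t) (iterate D F μr μc η α x₀ t ω) (D.Br t ω) (D.Bc t ω) (D.I t ω)
          (D.p t ω)

/-- The output `x̄_T`, an iterate picked uniformly at random. -/
noncomputable def output (D : Draws d Ξ Ω n) (F : Vec d → Ξ → ℝ) (μr μc : ℝ) (η α : ℕ → ℝ)
    (x₀ : Vec d) (ω : Ω) : Vec d :=
  D.iterate F μr μc η α x₀ (D.τ ω) ω

/-- `P̄_T = (1 / (d T)) ∑_{t < T} ∑_i 1 / p_{t,i}`. The probabilities may depend on random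
estimates; the expectation makes this a number, and does nothing if they are deterministic. -/
noncomputable def Pbar (D : Draws d Ξ Ω n) (P : Measure Ω) (T : ℕ) : ℝ :=
  ∫ ω, (1 / ((d : ℝ) * T)) * ∑ t ∈ Finset.range T, ∑ i, 1 / D.p t ω i ∂P

end Draws

/-- `d_nr = 1 + d / n_r`. -/
noncomputable def dnr (d n : ℕ) : ℝ := 1 + (d : ℝ) / n

end ZOHGD

/-!
The proof is the descent argument for stochastic gradient methods, applied to an estimator with a
small bias. Write `g = ∇f`, `σ² = d ζ²` and `δ = L μc √d`.

*The objective.* Every loss obeys the quadratic Taylor bound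
`|F(x + v) - F(x) - ⟪∇F(x), v⟫| ≤ L ‖v‖² / 2`. Integrating it in `ξ` shows that `f` is
differentiable with gradient `E ∇F(x; ξ)` and obeys the same bound (`objective_taylor`).

*Moments of the estimators at a fixed point.* By reflection invariance, a uniform direction `u` on the
sphere satisfies `E ⟪v, u⟫ ⟪w, u⟫ = ⟪v, w⟫ / d`. Replacing the losses by their linearizations costs at
most `d L μr / 2 = δ` per direction, so that the random estimator has bias at most `δ`
(`abs_integral_inner_rge_sub_le`), and its second moment is at most `2 d_nr (‖g‖² + σ²) + 2 δ²`
(`lintegral_rge_sq_le`): averaging `n` independent directions leaves `‖∇F‖²` from the mean and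
`(d / n) ‖∇F‖²` from the variance. Each coordinate of the coordinate-wise estimator has bias at most
`L μc / 2`.

*Conditioning.* The current batches are independent of the past, so these bounds hold along the run.
The event `i ∈ I_t` has conditional probability `p_{t,i}` given everything else: the weight `1 / p`
cancels in first moments (`le_integral_inner_cge`) and survives once in second moments
(`integral_cge_sq_le`), which makes the latter at most
`(2 / c_t) E‖g‖² + (5 / 2) ζ² E ∑ᵢ 1 / p_{t,i}`. This holds although the probabilities may depend on
the random estimate of the same step, because the coordinate-wise batch is independent of it.

*Summation.* The step size bound keeps the `‖g‖²`-part of the second moments below half of the gain of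
the descent lemma (`descent_step_bound`). Summing over `t < T` gives
`(η / 4) ∑ E‖g(x_t)‖² ≤ Δ + T η δ² / 2 + L η² T σ² (4 α² d_nr + (5 / 2) (1 - α)² P̄)`, and the choice of
`α` makes the last parenthesis at most `4 R` with `R = α d_nr` (`variance_weights`). The output is
drawn from `x_1, …, x_T` instead of `x_0, …, x_{T-1}`; the extra iterate is controlled by
`‖g(x_T)‖² ≤ 2 L (f(x_T) - inf f)`, whose contribution is `O(1 / T)`, and `1 / T = O(√(R / T))` because
`a / √(R T) ≤ η ≤ 1 / (24 L)` (`rate_bound`).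
-/

namespace ZOHGD

open Filter
open scoped InnerProductSpace Topology Pointwise

/-! ### Smooth functions -/

section Smooth

variable {E : Type*} [NormedAddCommGroup E] [InnerProductSpace ℝ E] [CompleteSpace E]

/-- The quadratic Taylor bound for a function with `L`-Lipschitz gradient. -/
theorem abs_sub_sub_inner_gradient_le {φ : E → ℝ} {L : ℝ} (hφ : Differentiable ℝ φ)
    (hL : ∀ x y, ‖gradient φ x - gradient φ y‖ ≤ L * ‖x - y‖) (x v : E) :
    |φ (x + v) - φ x - ⟪gradient φ x, v⟫_ℝ| ≤ L / 2 * ‖v‖ ^ 2 := by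
  have hderiv : ∀ s : ℝ, HasDerivAt (fun s : ℝ => φ (x + s • v) - φ x - s * ⟪gradient φ x, v⟫_ℝ)
      (⟪gradient φ (x + s • v) - gradient φ x, v⟫_ℝ) s := by
    intro s
    have h1 : HasDerivAt (fun s : ℝ => x + s • v) v s := by
      simpa using ((hasDerivAt_id s).smul_const v).const_add x
    have h2 := (hφ (x + s • v)).hasGradientAt.hasFDerivAt.comp_hasDerivAt s h1
    have h3 := (h2.sub_const (φ x)).sub ((hasDerivAt_id s).mul_const ⟪gradient φ x, v⟫_ℝ)
    refine HasDerivAt.congr_deriv h3 ?_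
    simp [inner_sub_left]
  have hB : ∀ s : ℝ, HasDerivAt (fun s : ℝ => L / 2 * ‖v‖ ^ 2 * s ^ 2) (L * ‖v‖ ^ 2 * s) s := by
    intro s
    have := (hasDerivAt_pow 2 s).const_mul (L / 2 * ‖v‖ ^ 2)
    refine this.congr_deriv ?_
    push_cast; ring
  have key := image_norm_le_of_norm_deriv_right_le_deriv_boundary
    (f := fun s : ℝ => φ (x + s • v) - φ x - s * ⟪gradient φ x, v⟫_ℝ)
    (B := fun s : ℝ => L / 2 * ‖v‖ ^ 2 * s ^ 2) (a := 0) (b := 1)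
    (fun s _ => (hderiv s).continuousAt.continuousWithinAt)
    (fun s _ => (hderiv s).hasDerivWithinAt) (by simp) hB
    (fun s hs => by
      calc ‖⟪gradient φ (x + s • v) - gradient φ x, v⟫_ℝ‖
          ≤ ‖gradient φ (x + s • v) - gradient φ x‖ * ‖v‖ := norm_inner_le_norm _ _
        _ ≤ L * ‖x + s • v - x‖ * ‖v‖ := by gcongr; exact hL _ _
        _ = L * ‖v‖ ^ 2 * s := by
          rw [add_sub_cancel_left, norm_smul, Real.norm_of_nonneg hs.1]; ring)
    (Set.right_mem_Icc.2 zero_le_one)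
  simpa using key

/-- A gradient step of length `1 / L` decreases the function by at least `‖∇φ‖² / (2 L)`. -/
theorem norm_gradient_sq_le {φ : E → ℝ} {L m : ℝ} (hL0 : 0 < L) (hφ : Differentiable ℝ φ)
    (hL : ∀ x y, ‖gradient φ x - gradient φ y‖ ≤ L * ‖x - y‖) (hm : ∀ y, m ≤ φ y) (x : E) :
    ‖gradient φ x‖ ^ 2 ≤ 2 * L * (φ x - m) := by
  have h := (abs_le.1 (abs_sub_sub_inner_gradient_le hφ hL x (-(1 / L) • gradient φ x))).2
  rw [real_inner_smul_right, real_inner_self_eq_norm_sq, norm_smul, norm_neg,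
    Real.norm_of_nonneg (by positivity)] at h
  have h2 := hm (x + -(1 / L) • gradient φ x)
  have h3 : L / 2 * (1 / L * ‖gradient φ x‖) ^ 2 = ‖gradient φ x‖ ^ 2 / (2 * L) := by
    field_simp
  have h4 : -(1 / L) * ‖gradient φ x‖ ^ 2 = - 2 * (‖gradient φ x‖ ^ 2 / (2 * L)) := by
    field_simp
  rw [h3, h4] at h
  have h5 : ‖gradient φ x‖ ^ 2 / (2 * L) ≤ φ x - m := by linarith
  rwa [div_le_iff₀ (by positivity), mul_comm] at h5

end Smooth

/-! ### The objective and its gradient -/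

section Objective

variable {d : ℕ} {Ξ : Type*} {F : Vec d → Ξ → ℝ} {L : ℝ}

theorem LipschitzGrad.taylor (hF : LipschitzGrad F L) (ξ : Ξ) (x v : Vec d) :
    |F (x + v) ξ - F x ξ - ⟪sampleGrad F x ξ, v⟫_ℝ| ≤ L / 2 * ‖v‖ ^ 2 :=
  abs_sub_sub_inner_gradient_le (hF.differentiable ξ) (hF.lipschitz ξ) x v

theorem sampleGrad_eq_sum (x : Vec d) (ξ : Ξ) :
    sampleGrad F x ξ = ∑ i, ⟪sampleGrad F x ξ, basisVec i⟫_ℝ • basisVec i := by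
  ext j
  simp [Finset.sum_apply, Pi.single_apply, EuclideanSpace.inner_single_right]

variable [MeasurableSpace Ξ] {ν : Measure Ξ}

theorem WellPosed.measurable_apply (hW : WellPosed F ν) (x : Vec d) : Measurable (F x) :=
  hW.measurable.comp measurable_prodMk_left

/-- Directional derivatives are limits of difference quotients, hence measurable in the sample. -/
theorem measurable_inner_sampleGrad (hW : WellPosed F ν) (hF : LipschitzGrad F L)
    (x v : Vec d) : Measurable fun ξ => ⟪sampleGrad F x ξ, v⟫_ℝ := by
  refine measurable_of_tendsto_metrizable
    (f := fun (n : ℕ) ξ => ((n : ℝ) + 1) * (F (x + (1 / ((n : ℝ) + 1)) • v) ξ - F x ξ))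
    (fun n => ((hW.measurable_apply _).sub (hW.measurable_apply _)).const_mul _) ?_
  rw [tendsto_pi_nhds]
  intro ξ
  rw [tendsto_iff_norm_sub_tendsto_zero]
  have hlim : Tendsto (fun n : ℕ => L / 2 * ‖v‖ ^ 2 * (1 / ((n : ℝ) + 1))) atTop (𝓝 0) := by
    have := (tendsto_one_div_add_atTop_nhds_zero_nat (𝕜 := ℝ)).const_mul (L / 2 * ‖v‖ ^ 2)
    rwa [mul_zero] at this
  refine squeeze_zero (fun _ => norm_nonneg _) (fun n => ?_) hlim
  have hn : (0 : ℝ) < (n : ℝ) + 1 := by positivity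
  have h := hF.taylor ξ x ((1 / ((n : ℝ) + 1)) • v)
  rw [real_inner_smul_right, norm_smul, Real.norm_of_nonneg (by positivity)] at h
  have h2 : ((n : ℝ) + 1) * (F (x + (1 / ((n : ℝ) + 1)) • v) ξ - F x ξ) - ⟪sampleGrad F x ξ, v⟫_ℝ
      = ((n : ℝ) + 1) * (F (x + (1 / ((n : ℝ) + 1)) • v) ξ - F x ξ
        - 1 / ((n : ℝ) + 1) * ⟪sampleGrad F x ξ, v⟫_ℝ) := by
    field_simp
  rw [h2, norm_mul, Real.norm_of_nonneg hn.le, Real.norm_eq_abs]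
  calc ((n : ℝ) + 1) * _ ≤ ((n : ℝ) + 1) * (L / 2 * (1 / ((n : ℝ) + 1) * ‖v‖) ^ 2) := by gcongr
    _ = _ := by field_simp

/-- By the Taylor bound, a directional derivative differs from the integrable increment
`F (x + v) - F x` by a bounded function. -/
theorem integrable_inner_sampleGrad [IsProbabilityMeasure ν] (hW : WellPosed F ν)
    (hF : LipschitzGrad F L) (x v : Vec d) :
    Integrable (fun ξ => ⟪sampleGrad F x ξ, v⟫_ℝ) ν := by
  refine Integrable.mono' (g := fun ξ => |F (x + v) ξ - F x ξ| + L / 2 * ‖v‖ ^ 2)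
    (((hW.integrable _).sub (hW.integrable _)).abs.add (integrable_const _))
    (measurable_inner_sampleGrad hW hF x v).aestronglyMeasurable (ae_of_all _ fun ξ => ?_)
  have h := hF.taylor ξ x v
  rw [Real.norm_eq_abs]
  have := abs_sub_abs_le_abs_sub (⟪sampleGrad F x ξ, v⟫_ℝ) (F (x + v) ξ - F x ξ)
  rw [abs_sub_comm (⟪sampleGrad F x ξ, v⟫_ℝ)] at this
  linarith

theorem integrable_sampleGrad [IsProbabilityMeasure ν] (hW : WellPosed F ν)
    (hF : LipschitzGrad F L) (x : Vec d) : Integrable (sampleGrad F x) ν := by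
  rw [funext (sampleGrad_eq_sum (F := F) x)]
  exact integrable_finsetSum _ fun i _ => (integrable_inner_sampleGrad hW hF x _).smul_const _

/-- Integrating the quadratic Taylor bound of the samples; this is what allows to differentiate
under the expectation without any domination hypothesis. -/
theorem objective_taylor_aux [IsProbabilityMeasure ν] (hW : WellPosed F ν)
    (hF : LipschitzGrad F L) (x v : Vec d) :
    |objective F ν (x + v) - objective F ν x - ⟪∫ ξ, sampleGrad F x ξ ∂ν, v⟫_ℝ|
      ≤ L / 2 * ‖v‖ ^ 2 := by
  have h1 : ⟪∫ ξ, sampleGrad F x ξ ∂ν, v⟫_ℝ = ∫ ξ, ⟪sampleGrad F x ξ, v⟫_ℝ ∂ν := by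
    rw [real_inner_comm, ← integral_inner (integrable_sampleGrad hW hF x)]
    simp_rw [real_inner_comm]
  rw [h1, objective, objective, ← integral_sub (hW.integrable _) (hW.integrable _),
    ← integral_sub (f := fun ξ => F (x + v) ξ - F x ξ)
      ((hW.integrable _).sub (hW.integrable _)) (integrable_inner_sampleGrad hW hF x v)]
  have := norm_integral_le_of_norm_le_const (μ := ν)
    (ae_of_all _ fun ξ => (Real.norm_eq_abs _).trans_le (hF.taylor ξ x v))
  simpa using this

theorem hasGradientAt_objective [IsProbabilityMeasure ν] (hW : WellPosed F ν)
    (hF : LipschitzGrad F L) (x : Vec d) :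
    HasGradientAt (objective F ν) (∫ ξ, sampleGrad F x ξ ∂ν) x := by
  rw [hasGradientAt_iff_isLittleO_nhds_zero]
  refine Asymptotics.IsBigO.trans_isLittleO (g := fun v : Vec d => ‖v‖ ^ 2) ?_ ?_
  · refine Asymptotics.IsBigO.of_bound (L / 2) (Eventually.of_forall fun v => ?_)
    simpa using objective_taylor_aux hW hF x v
  · simpa using Asymptotics.isLittleO_norm_pow_id (E' := Vec d) one_lt_two

theorem gradient_objective [IsProbabilityMeasure ν] (hW : WellPosed F ν)
    (hF : LipschitzGrad F L) (x : Vec d) :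
    gradient (objective F ν) x = ∫ ξ, sampleGrad F x ξ ∂ν :=
  (hasGradientAt_objective hW hF x).gradient

theorem integral_inner_sampleGrad [IsProbabilityMeasure ν] (hW : WellPosed F ν)
    (hF : LipschitzGrad F L) (x v : Vec d) :
    ∫ ξ, ⟪sampleGrad F x ξ, v⟫_ℝ ∂ν = ⟪gradient (objective F ν) x, v⟫_ℝ := by
  rw [gradient_objective hW hF, real_inner_comm, ← integral_inner (integrable_sampleGrad hW hF x)]
  simp_rw [real_inner_comm]

theorem integrable_sampleGrad_apply [IsProbabilityMeasure ν] (hW : WellPosed F ν)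
    (hF : LipschitzGrad F L) (x : Vec d) (i : Fin d) :
    Integrable (fun ξ => sampleGrad F x ξ i) ν := by
  simpa [EuclideanSpace.inner_single_right] using
    integrable_inner_sampleGrad hW hF x (basisVec i)

theorem integral_sampleGrad_apply [IsProbabilityMeasure ν] (hW : WellPosed F ν)
    (hF : LipschitzGrad F L) (x : Vec d) (i : Fin d) :
    ∫ ξ, sampleGrad F x ξ i ∂ν = gradient (objective F ν) x i := by
  have h := integral_inner_sampleGrad hW hF x (basisVec i)
  simpa only [EuclideanSpace.inner_single_right, conj_trivial, one_mul] using h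

theorem differentiable_objective [IsProbabilityMeasure ν] (hW : WellPosed F ν)
    (hF : LipschitzGrad F L) : Differentiable ℝ (objective F ν) :=
  fun x => (hasGradientAt_objective hW hF x).differentiableAt

theorem lipschitz_gradient_objective [IsProbabilityMeasure ν] (hW : WellPosed F ν)
    (hF : LipschitzGrad F L) (x y : Vec d) :
    ‖gradient (objective F ν) x - gradient (objective F ν) y‖ ≤ L * ‖x - y‖ := by
  rw [gradient_objective hW hF, gradient_objective hW hF,
    ← integral_sub (integrable_sampleGrad hW hF x) (integrable_sampleGrad hW hF y)]
  simpa using norm_integral_le_of_norm_le_const (μ := ν)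
    (ae_of_all _ fun ξ => hF.lipschitz ξ x y)

theorem continuous_gradient_objective [IsProbabilityMeasure ν] (hW : WellPosed F ν)
    (hF : LipschitzGrad F L) : Continuous (gradient (objective F ν)) :=
  (LipschitzWith.of_dist_le' fun x y => by
    simpa [dist_eq_norm] using lipschitz_gradient_objective hW hF x y).continuous

theorem objective_taylor [IsProbabilityMeasure ν] (hW : WellPosed F ν)
    (hF : LipschitzGrad F L) (x v : Vec d) :
    |objective F ν (x + v) - objective F ν x - ⟪gradient (objective F ν) x, v⟫_ℝ|
      ≤ L / 2 * ‖v‖ ^ 2 := by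
  rw [gradient_objective hW hF]
  exact objective_taylor_aux hW hF x v

end Objective

/-! ### The uniform distribution on the sphere -/

section Sphere

variable {d : ℕ}

theorem isProbabilityMeasure_sphereUnif (hd : 1 ≤ d) : IsProbabilityMeasure (sphereUnif d) := by
  have : NeZero d := ⟨by omega⟩
  have : Nontrivial (Vec d) := by infer_instance
  refine ⟨?_⟩
  rw [sphereUnif, Measure.smul_apply, Measure.map_apply measurable_subtype_coe .univ,
    Set.preimage_univ, smul_eq_mul, ENNReal.inv_mul_cancel]
  · exact Measure.measure_univ_ne_zero.2 (Measure.toSphere_ne_zero _)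
  · exact measure_ne_top _ _

theorem ae_norm_sphereUnif : ∀ᵐ u ∂(sphereUnif d), ‖u‖ = 1 := by
  refine Measure.ae_smul_measure ?_ _
  rw [ae_map_iff measurable_subtype_coe.aemeasurable
    (measurableSet_eq_fun measurable_norm measurable_const)]
  exact ae_of_all _ fun u => by simp

/-- The uniform distribution on the sphere is invariant under linear isometries, because Lebesgue
measure is. -/
theorem map_sphereUnif (A : Vec d ≃ₗᵢ[ℝ] Vec d) : (sphereUnif d).map A = sphereUnif d := by
  have hA : Measurable A := A.continuous.measurable
  rw [sphereUnif, Measure.map_smul, Measure.map_map hA measurable_subtype_coe]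
  congr 1
  ext s hs
  rw [Measure.map_apply (hA.comp measurable_subtype_coe) hs,
    Measure.map_apply measurable_subtype_coe hs,
    Measure.toSphere_apply' _ ((hA.comp measurable_subtype_coe) hs),
    Measure.toSphere_apply' _ (measurable_subtype_coe hs)]
  congr 1
  rw [← A.measurePreserving.measure_preimage_emb A.toHomeomorph.measurableEmbedding
    (Set.Ioo (0 : ℝ) 1 • (Subtype.val '' (Subtype.val ⁻¹' s)))]
  congr 1
  ext x
  simp only [Set.mem_smul, Set.mem_image, Set.mem_preimage, Function.comp_apply, Subtype.exists,
    mem_sphere_zero_iff_norm, exists_and_left, exists_prop, exists_eq_right_right]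
  constructor
  · rintro ⟨r, hr, y, ⟨hy, h1⟩, rfl⟩
    exact ⟨r, hr, A y, ⟨hy, by simpa using h1⟩, by simp⟩
  · rintro ⟨r, hr, y, ⟨hy, h1⟩, hx⟩
    refine ⟨r, hr, A.symm y, ⟨by simpa using hy, by simpa using h1⟩, ?_⟩
    apply A.injective
    simpa using hx

theorem integrable_sphereUnif_of_bound (hd : 1 ≤ d) {E : Type*} [NormedAddCommGroup E]
    {φ : Vec d → E} (hφ : AEStronglyMeasurable φ (sphereUnif d)) {C : ℝ}
    (hC : ∀ u, ‖u‖ = 1 → ‖φ u‖ ≤ C) : Integrable φ (sphereUnif d) := by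
  have := isProbabilityMeasure_sphereUnif hd
  exact Integrable.of_bound hφ C (ae_norm_sphereUnif.mono hC)

theorem integrable_inner_mul_inner_sphereUnif (hd : 1 ≤ d) (v w : Vec d) :
    Integrable (fun u => ⟪v, u⟫_ℝ * ⟪w, u⟫_ℝ) (sphereUnif d) := by
  refine integrable_sphereUnif_of_bound hd (C := ‖v‖ * ‖w‖) (by fun_prop) fun u hu => ?_
  rw [norm_mul]
  have h1 := norm_inner_le_norm (𝕜 := ℝ) v u
  have h2 := norm_inner_le_norm (𝕜 := ℝ) w u
  rw [hu, mul_one] at h1 h2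
  gcongr

/-- `E ⟪v, u⟫²` depends on `‖v‖` only: a reflection maps `v` to any `w` of the same norm. -/
theorem integral_inner_sq_sphereUnif_eq {v w : Vec d} (h : ‖v‖ = ‖w‖) :
    ∫ u, ⟪v, u⟫_ℝ ^ 2 ∂(sphereUnif d) = ∫ u, ⟪w, u⟫_ℝ ^ 2 ∂(sphereUnif d) := by
  set A : Vec d ≃ₗᵢ[ℝ] Vec d := (ℝ ∙ (v - w))ᗮ.reflection with hA
  have hAv : A v = w := Submodule.reflection_sub h
  have hinner : ∀ u, ⟪w, A u⟫_ℝ = ⟪v, u⟫_ℝ := fun u => by rw [← hAv, A.inner_map_map]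
  conv_rhs => rw [← map_sphereUnif A]
  rw [A.toHomeomorph.measurableEmbedding.integral_map (f := A)]
  simp [hinner]

/-- Summing over an orthonormal basis gives `∑ᵢ E ⟪eᵢ, u⟫² = E ‖u‖² = 1`, and the summands are
equal. -/
theorem integral_inner_sq_sphereUnif (hd : 1 ≤ d) (v : Vec d) :
    ∫ u, ⟪v, u⟫_ℝ ^ 2 ∂(sphereUnif d) = ‖v‖ ^ 2 / d := by
  have := isProbabilityMeasure_sphereUnif hd
  have h1 : ∀ i : Fin d, ∫ u, ⟪v, u⟫_ℝ ^ 2 ∂(sphereUnif d)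
      = ∫ u, ⟪‖v‖ • basisVec i, u⟫_ℝ ^ 2 ∂(sphereUnif d) := fun i =>
    integral_inner_sq_sphereUnif_eq (by simp [norm_smul])
  have h2 : ∑ _i : Fin d, ∫ u, ⟪v, u⟫_ℝ ^ 2 ∂(sphereUnif d) = ‖v‖ ^ 2 := by
    rw [Finset.sum_congr rfl fun i _ => h1 i, ← integral_finsetSum]
    · calc _ = ∫ u, ‖v‖ ^ 2 ∂(sphereUnif d) := by
            refine integral_congr_ae (ae_norm_sphereUnif.mono fun u hu => ?_)
            simp only [real_inner_smul_left, mul_pow, ← Finset.mul_sum,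
              EuclideanSpace.inner_single_left]
            have := EuclideanSpace.norm_sq_eq u
            rw [hu] at this
            simp at this
            simp [← this]
        _ = _ := by simp
    · intro i _
      simpa [sq] using integrable_inner_mul_inner_sphereUnif hd (‖v‖ • basisVec i)
        (‖v‖ • basisVec i)
  rw [Finset.sum_const, Finset.card_univ, Fintype.card_fin, nsmul_eq_mul] at h2
  have : (d : ℝ) ≠ 0 := by positivity
  field_simp
  linarith

/-- The polarization of `integral_inner_sq_sphereUnif`. -/
theorem integral_inner_mul_inner_sphereUnif (hd : 1 ≤ d) (v w : Vec d) :
    ∫ u, ⟪v, u⟫_ℝ * ⟪w, u⟫_ℝ ∂(sphereUnif d) = ⟪v, w⟫_ℝ / d := by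
  have h1 : ∀ u, ⟪v, u⟫_ℝ * ⟪w, u⟫_ℝ
      = (1 / 4) * (⟪v + w, u⟫_ℝ ^ 2 - ⟪v - w, u⟫_ℝ ^ 2) := fun u => by
    rw [inner_add_left, inner_sub_left]; ring
  have hi : ∀ z : Vec d, Integrable (fun u => ⟪z, u⟫_ℝ ^ 2) (sphereUnif d) := fun z => by
    simpa [sq] using integrable_inner_mul_inner_sphereUnif hd z z
  simp_rw [h1]
  rw [integral_const_mul, integral_sub (hi _) (hi _), integral_inner_sq_sphereUnif hd,
    integral_inner_sq_sphereUnif hd, norm_add_sq_real, norm_sub_sq_real]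
  ring

end Sphere

/-! ### Averages over product measures -/

section Averages

theorem norm_average_sq_le {E : Type*} [NormedAddCommGroup E] [NormedSpace ℝ E] {b : ℕ}
    (v : Fin b → E) : ‖(1 / (b : ℝ)) • ∑ j, v j‖ ^ 2 ≤ (1 / (b : ℝ)) * ∑ j, ‖v j‖ ^ 2 := by
  rcases Nat.eq_zero_or_pos b with rfl | hb
  · simp
  have hb' : (0 : ℝ) < b := by exact_mod_cast hb
  rw [norm_smul, Real.norm_of_nonneg (by positivity), mul_pow]
  have h1 : ‖∑ j, v j‖ ^ 2 ≤ b * ∑ j, ‖v j‖ ^ 2 := by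
    calc ‖∑ j, v j‖ ^ 2 ≤ (∑ j, ‖v j‖) ^ 2 := by gcongr; exact norm_sum_le _ _
      _ ≤ _ := by simpa using sq_sum_le_card_mul_sum_sq (s := Finset.univ) (f := fun j => ‖v j‖)
  calc (1 / (b : ℝ)) ^ 2 * ‖∑ j, v j‖ ^ 2
      ≤ (1 / (b : ℝ)) ^ 2 * (b * ∑ j, ‖v j‖ ^ 2) := by gcongr
    _ = _ := by field_simp

/-- The second moment of an average is at most the second moment of one term (Jensen). -/
theorem lintegral_average_sq_le {α E : Type*} [MeasurableSpace α] {ρ : Measure α}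
    [IsProbabilityMeasure ρ] [NormedAddCommGroup E] [NormedSpace ℝ E] [MeasurableSpace E]
    [BorelSpace E] {b : ℕ} {φ : α → E} (hφ : Measurable φ) :
    ∫⁻ B, ENNReal.ofReal (‖(1 / (b : ℝ)) • ∑ j, φ (B j)‖ ^ 2) ∂(Measure.pi fun _ : Fin b => ρ)
      ≤ ∫⁻ z, ENNReal.ofReal (‖φ z‖ ^ 2) ∂ρ := by
  have hm : Measurable fun z => ENNReal.ofReal (‖φ z‖ ^ 2) := by fun_prop
  have h1 : ∀ B : Fin b → α, ENNReal.ofReal (‖(1 / (b : ℝ)) • ∑ j, φ (B j)‖ ^ 2)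
      ≤ ENNReal.ofReal (1 / (b : ℝ)) * ∑ j, ENNReal.ofReal (‖φ (B j)‖ ^ 2) := fun B => by
    rw [← ENNReal.ofReal_sum_of_nonneg fun _ _ => by positivity,
      ← ENNReal.ofReal_mul (by positivity)]
    exact ENNReal.ofReal_le_ofReal (norm_average_sq_le _)
  refine (lintegral_mono h1).trans ?_
  have hmj : ∀ j : Fin b, Measurable fun B : Fin b → α => ENNReal.ofReal (‖φ (B j)‖ ^ 2) :=
    fun j => hm.comp (measurable_pi_apply j)
  rw [lintegral_const_mul _ (Finset.measurable_sum _ fun j _ => hmj j),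
    lintegral_finsetSum _ fun j _ => hmj j]
  have h2 : ∀ j : Fin b, ∫⁻ B, ENNReal.ofReal (‖φ (B j)‖ ^ 2) ∂(Measure.pi fun _ : Fin b => ρ)
      = ∫⁻ z, ENNReal.ofReal (‖φ z‖ ^ 2) ∂ρ := fun j =>
    (measurePreserving_eval (fun _ : Fin b => ρ) j).lintegral_comp hm
  simp only [h2, Finset.sum_const, Finset.card_univ, Fintype.card_fin, nsmul_eq_mul, ← mul_assoc]
  calc _ ≤ 1 * ∫⁻ z, ENNReal.ofReal (‖φ z‖ ^ 2) ∂ρ := by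
        gcongr
        rw [← ENNReal.ofReal_natCast, ← ENNReal.ofReal_mul (by positivity), ENNReal.ofReal_le_one,
          one_div]
        exact inv_mul_le_one
    _ = _ := one_mul _

theorem integral_average {α : Type*} [MeasurableSpace α] {ρ : Measure α}
    [IsProbabilityMeasure ρ] {b : ℕ} (hb : 1 ≤ b) {φ : α → ℝ} (hφ : Integrable φ ρ) :
    Integrable (fun B : Fin b → α => (1 / (b : ℝ)) * ∑ j, φ (B j)) (Measure.pi fun _ => ρ) ∧
    ∫ B, (1 / (b : ℝ)) * ∑ j, φ (B j) ∂(Measure.pi fun _ : Fin b => ρ) = ∫ z, φ z ∂ρ := by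
  have hp := fun j => measurePreserving_eval (fun _ : Fin b => ρ) j
  have hi : ∀ j : Fin b, Integrable (fun B : Fin b → α => φ (B j)) (Measure.pi fun _ => ρ) :=
    fun j => (hp j).integrable_comp_of_integrable hφ
  refine ⟨(integrable_finsetSum _ fun j _ => hi j).const_mul _, ?_⟩
  rw [integral_const_mul, integral_finsetSum _ fun j _ => hi j]
  have h2 : ∀ j : Fin b, ∫ B, φ (B j) ∂(Measure.pi fun _ : Fin b => ρ) = ∫ z, φ z ∂ρ := fun j => by
    conv_rhs => rw [← (hp j).map_eq]
    rw [integral_map (hp j).aemeasurable (by rw [(hp j).map_eq]; exact hφ.aestronglyMeasurable)]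
  have : (b : ℝ) ≠ 0 := by positivity
  simp only [h2, Finset.sum_const, Finset.card_univ, Fintype.card_fin, nsmul_eq_mul]
  field_simp

/-- The second moment of a sum of `n` independent copies of `X`: the variances add up. -/
theorem integral_sum_sq_le {α : Type*} [MeasurableSpace α] {ρ : Measure α}
    [IsProbabilityMeasure ρ] (n : ℕ) {X : α → ℝ} (hX : MemLp X 2 ρ) :
    Integrable (fun u : Fin n → α => (∑ k, X (u k)) ^ 2) (Measure.pi fun _ => ρ) ∧
    ∫ u, (∑ k, X (u k)) ^ 2 ∂(Measure.pi fun _ : Fin n => ρ)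
      ≤ n * ∫ z, X z ^ 2 ∂ρ + n ^ 2 * (∫ z, X z ∂ρ) ^ 2 := by
  have hp := fun j => measurePreserving_eval (fun _ : Fin n => ρ) j
  have hi : ∀ j : Fin n, MemLp (fun u : Fin n → α => X (u j)) 2 (Measure.pi fun _ => ρ) :=
    fun j => hX.comp_measurePreserving (hp j)
  have hS : MemLp (∑ k, fun u : Fin n → α => X (u k)) 2 (Measure.pi fun _ => ρ) :=
    memLp_finsetSum' _ fun j _ => hi j
  have hS2 : ∀ u : Fin n → α, (∑ k, fun u : Fin n → α => X (u k)) u = ∑ k, X (u k) :=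
    fun u => by simp
  have h2 : ∀ j : Fin n, ∫ u, X (u j) ∂(Measure.pi fun _ : Fin n => ρ) = ∫ z, X z ∂ρ := fun j => by
    conv_rhs => rw [← (hp j).map_eq]
    rw [integral_map (hp j).aemeasurable (by rw [(hp j).map_eq]; exact hX.aestronglyMeasurable)]
  refine ⟨by simpa only [hS2] using hS.integrable_sq, ?_⟩
  have hv := variance_sum_pi (μ := fun _ : Fin n => ρ) (X := fun _ => X) fun _ => hX
  rw [variance_eq_sub hS] at hv
  simp only [Pi.pow_apply, hS2] at hv
  rw [integral_finsetSum _ fun j _ => (hi j).integrable one_le_two] at hv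
  simp only [h2, Finset.sum_const, Finset.card_univ, Fintype.card_fin, nsmul_eq_mul] at hv
  have hv2 : Var[X; ρ] ≤ ∫ z, X z ^ 2 ∂ρ := variance_le_expectation_sq hX.aestronglyMeasurable
  have hv3 : (n : ℝ) * Var[X; ρ] ≤ n * ∫ z, X z ^ 2 ∂ρ := by gcongr
  rw [mul_pow] at hv
  linarith

theorem lintegral_ofReal_affine_le {α : Type*} [MeasurableSpace α] {ρ : Measure α}
    [IsProbabilityMeasure ρ] {φ : α → ℝ} {a c M : ℝ} (ha : 0 ≤ a) (hc : 0 ≤ c)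
    (hφ : Integrable φ ρ) (hφ0 : ∀ z, 0 ≤ φ z) (hM : ∫ z, φ z ∂ρ ≤ M) :
    ∫⁻ z, ENNReal.ofReal (a * φ z + c) ∂ρ ≤ ENNReal.ofReal (a * M + c) := by
  have hi : Integrable (fun z => a * φ z + c) ρ := (hφ.const_mul a).add (integrable_const c)
  rw [← ofReal_integral_eq_lintegral_ofReal hi
    (ae_of_all _ fun z => add_nonneg (mul_nonneg ha (hφ0 z)) hc)]
  refine ENNReal.ofReal_le_ofReal ?_
  rw [integral_add (hφ.const_mul a) (integrable_const c), integral_const_mul]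
  simp only [integral_const, probReal_univ, one_smul]
  gcongr

end Averages

/-! ### Moments of the random gradient estimator -/

section RGE

variable {d : ℕ} {Ξ : Type*} {F : Vec d → Ξ → ℝ} {L μr : ℝ}

/-- The random gradient estimator of one sample along a single direction. -/
noncomputable def rgeDir (F : Vec d → Ξ → ℝ) (μr : ℝ) (x : Vec d) (ξ : Ξ) (u : Vec d) : Vec d :=
  (((d : ℝ) * (F (x + μr • u) ξ - F x ξ)) / μr) • u

/-- The value that `rgeDir` would have if the loss were affine. -/
noncomputable def rgeLin (F : Vec d → Ξ → ℝ) (x : Vec d) (ξ : Ξ) (u : Vec d) : Vec d :=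
  ((d : ℝ) * ⟪sampleGrad F x ξ, u⟫_ℝ) • u

theorem norm_rgeDir_sub_rgeLin_le (hF : LipschitzGrad F L) (hμ : 0 < μr) (x : Vec d) (ξ : Ξ)
    {u : Vec d} (hu : ‖u‖ = 1) :
    ‖rgeDir F μr x ξ u - rgeLin F x ξ u‖ ≤ d * L * μr / 2 := by
  have h := hF.taylor ξ x (μr • u)
  rw [norm_smul, hu, mul_one, real_inner_smul_right, Real.norm_of_nonneg hμ.le] at h
  rw [rgeDir, rgeLin, ← sub_smul, norm_smul, hu, mul_one, Real.norm_eq_abs]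
  have h2 : (d : ℝ) * (F (x + μr • u) ξ - F x ξ) / μr - d * ⟪sampleGrad F x ξ, u⟫_ℝ
      = d / μr * (F (x + μr • u) ξ - F x ξ - μr * ⟪sampleGrad F x ξ, u⟫_ℝ) := by
    field_simp
  rw [h2, abs_mul, abs_of_nonneg (by positivity)]
  calc (d : ℝ) / μr * _ ≤ d / μr * (L / 2 * μr ^ 2) := by gcongr
    _ = _ := by field_simp

theorem norm_rgeLin_le (x : Vec d) (ξ : Ξ) {u : Vec d} (hu : ‖u‖ = 1) :
    ‖rgeLin F x ξ u‖ ≤ d * ‖sampleGrad F x ξ‖ := by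
  rw [rgeLin, norm_smul, hu, mul_one, norm_mul, Real.norm_natCast]
  gcongr
  simpa [hu] using norm_inner_le_norm (𝕜 := ℝ) (sampleGrad F x ξ) u

theorem rgeSample_eq {n : ℕ} (x : Vec d) (ξ : Ξ) (u : Fin n → Vec d) :
    rgeSample F μr x ξ u = (1 / (n : ℝ)) • ∑ k, rgeDir F μr x ξ (u k) := rfl

theorem measurable_rgeLin (x : Vec d) (ξ : Ξ) : Measurable (rgeLin F x ξ) := by
  unfold rgeLin
  fun_prop

/-- Averaging `n` independent directions: `‖∇F‖²` from the mean plus `(d / n) ‖∇F‖²` from the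
variance. -/
theorem integral_norm_sum_rgeLin_sq_le {n : ℕ} (hd : 1 ≤ d) (hn : 1 ≤ n) (x : Vec d) (ξ : Ξ) :
    Integrable (fun u : Fin n → Vec d => ‖(1 / (n : ℝ)) • ∑ k, rgeLin F x ξ (u k)‖ ^ 2)
      (Measure.pi fun _ : Fin n => sphereUnif d) ∧
    ∫ u, ‖(1 / (n : ℝ)) • ∑ k, rgeLin F x ξ (u k)‖ ^ 2 ∂(Measure.pi fun _ : Fin n => sphereUnif d)
      ≤ dnr d n * ‖sampleGrad F x ξ‖ ^ 2 := by
  have := isProbabilityMeasure_sphereUnif hd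
  set G := sampleGrad F x ξ with hG
  have hmem : ∀ i : Fin d, MemLp (fun u => rgeLin F x ξ u i) 2 (sphereUnif d) := fun i => by
    refine MemLp.of_bound (C := d * ‖G‖) ?_ ?_
    · exact ((measurable_pi_apply i).comp
        ((WithLp.measurable_ofLp 2 _).comp (measurable_rgeLin x ξ))).aestronglyMeasurable
    · exact ae_norm_sphereUnif.mono fun u hu =>
        (PiLp.norm_apply_le _ i).trans (norm_rgeLin_le x ξ hu)
  have hmean : ∀ i : Fin d, ∫ u, rgeLin F x ξ u i ∂(sphereUnif d) = G i := fun i => by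
    have h := integral_inner_mul_inner_sphereUnif hd G (basisVec i)
    simp only [EuclideanSpace.inner_single_left, EuclideanSpace.inner_single_right] at h
    simp only [map_one, one_mul, conj_trivial] at h
    simp only [rgeLin, PiLp.smul_apply, smul_eq_mul, mul_assoc]
    rw [integral_const_mul, h]
    field_simp
  have hsq : ∑ i : Fin d, ∫ u, rgeLin F x ξ u i ^ 2 ∂(sphereUnif d) = d * ‖G‖ ^ 2 := by
    rw [← integral_finsetSum _ fun i _ => (hmem i).integrable_sq]
    have h1 : ∀ᵐ u ∂(sphereUnif d), ∑ i, rgeLin F x ξ u i ^ 2 = d ^ 2 * ⟪G, u⟫_ℝ ^ 2 :=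
      ae_norm_sphereUnif.mono fun u hu => by
        rw [← EuclideanSpace.real_norm_sq_eq, rgeLin, norm_smul, hu, mul_one, Real.norm_eq_abs,
          sq_abs, mul_pow]
    rw [integral_congr_ae h1, integral_const_mul, integral_inner_sq_sphereUnif hd]
    field_simp
  have hexp : ∀ u : Fin n → Vec d, ‖(1 / (n : ℝ)) • ∑ k, rgeLin F x ξ (u k)‖ ^ 2
      = (1 / (n : ℝ)) ^ 2 * ∑ i, (∑ k, rgeLin F x ξ (u k) i) ^ 2 := fun u => by
    rw [norm_smul, mul_pow, Real.norm_eq_abs, sq_abs, EuclideanSpace.real_norm_sq_eq]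
    simp [WithLp.ofLp_sum, Finset.sum_apply]
  have hs := fun i => integral_sum_sq_le n (hmem i)
  simp only [hexp]
  refine ⟨(integrable_finsetSum _ fun i _ => (hs i).1).const_mul _, ?_⟩
  rw [integral_const_mul, integral_finsetSum _ fun i _ => (hs i).1]
  calc (1 / (n : ℝ)) ^ 2 * _
      ≤ (1 / (n : ℝ)) ^ 2 * ∑ i, (n * ∫ u, rgeLin F x ξ u i ^ 2 ∂(sphereUnif d)
          + n ^ 2 * (∫ u, rgeLin F x ξ u i ∂(sphereUnif d)) ^ 2) := by
        gcongr with i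
        exact (hs i).2
    _ = dnr d n * ‖G‖ ^ 2 := by
        simp only [hmean]
        rw [Finset.sum_add_distrib, ← Finset.mul_sum, ← Finset.mul_sum, hsq,
          ← EuclideanSpace.real_norm_sq_eq, dnr]
        field_simp
        ring

/-- Second moment of the random gradient estimator of one sample, with respect to the directions:
the linearized estimator plus an error of size at most `d L μr / 2`. -/
theorem lintegral_rgeSample_sq_le {n : ℕ} (hd : 1 ≤ d) (hn : 1 ≤ n)
    (hF : LipschitzGrad F L) (hμ : 0 < μr) (x : Vec d) (ξ : Ξ) :
    ∫⁻ u, ENNReal.ofReal (‖rgeSample F μr x ξ u‖ ^ 2) ∂(Measure.pi fun _ : Fin n => sphereUnif d)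
      ≤ ENNReal.ofReal (2 * (dnr d n * ‖sampleGrad F x ξ‖ ^ 2) + 2 * (d * L * μr / 2) ^ 2) := by
  have := isProbabilityMeasure_sphereUnif hd
  obtain ⟨hi, hle⟩ := integral_norm_sum_rgeLin_sq_le (F := F) (n := n) hd hn x ξ
  have hsph : ∀ᵐ u ∂(Measure.pi fun _ : Fin n => sphereUnif d), ∀ k, ‖u k‖ = 1 := by
    rw [ae_all_iff]
    exact fun k => (measurePreserving_eval (fun _ : Fin n => sphereUnif d)
      k).quasiMeasurePreserving.ae ae_norm_sphereUnif
  have hpt : ∀ᵐ u ∂(Measure.pi fun _ : Fin n => sphereUnif d),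
      ENNReal.ofReal (‖rgeSample F μr x ξ u‖ ^ 2) ≤ ENNReal.ofReal
        (2 * ‖(1 / (n : ℝ)) • ∑ k, rgeLin F x ξ (u k)‖ ^ 2 + 2 * (d * L * μr / 2) ^ 2) := by
    filter_upwards [hsph] with u hu
    refine ENNReal.ofReal_le_ofReal ?_
    set v := (1 / (n : ℝ)) • ∑ k, rgeLin F x ξ (u k) with hv
    have h1 : ‖rgeSample F μr x ξ u - v‖ ≤ d * L * μr / 2 := by
      rw [hv, rgeSample_eq, ← smul_sub, ← Finset.sum_sub_distrib, norm_smul,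
        Real.norm_of_nonneg (by positivity)]
      calc (1 / (n : ℝ)) * _ ≤ (1 / (n : ℝ)) * ∑ _k : Fin n, (d * L * μr / 2) := by
            gcongr
            exact norm_sum_le_of_le _ fun k _ => norm_rgeDir_sub_rgeLin_le hF hμ x ξ (hu k)
        _ = _ := by
            rw [Finset.sum_const, Finset.card_univ, Fintype.card_fin, nsmul_eq_mul]
            field_simp
    have h2 : ‖rgeSample F μr x ξ u‖ ≤ ‖v‖ + d * L * μr / 2 := by
      linarith [norm_sub_norm_le (rgeSample F μr x ξ u) v]
    calc ‖rgeSample F μr x ξ u‖ ^ 2 ≤ (‖v‖ + d * L * μr / 2) ^ 2 := by gcongr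
      _ ≤ _ := by linarith [add_sq_le (a := ‖v‖) (b := d * L * μr / 2)]
  refine (lintegral_mono_ae hpt).trans ?_
  exact lintegral_ofReal_affine_le (by positivity) (by positivity) hi
    (fun _ => by positivity) hle

variable [MeasurableSpace Ξ] {ν : Measure Ξ}

theorem measurable_rgeDir (hW : WellPosed F ν) (μr : ℝ) :
    Measurable fun q : Vec d × Ξ × Vec d => rgeDir F μr q.1 q.2.1 q.2.2 := by
  have h1 : Measurable fun q : Vec d × Ξ × Vec d => F (q.1 + μr • q.2.2) q.2.1 :=
    hW.measurable.comp (f := fun q : Vec d × Ξ × Vec d => (q.1 + μr • q.2.2, q.2.1)) (by fun_prop)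
  have h2 : Measurable fun q : Vec d × Ξ × Vec d => F q.1 q.2.1 :=
    hW.measurable.comp (f := fun q : Vec d × Ξ × Vec d => (q.1, q.2.1)) (by fun_prop)
  unfold rgeDir
  exact (((h1.sub h2).const_mul _).div_const _).smul (by fun_prop)

theorem measurable_rge (hW : WellPosed F ν) (μr : ℝ) (n b : ℕ) :
    Measurable fun q : Vec d × (Fin b → Ξ × (Fin n → Vec d)) => rge F μr q.1 q.2 := by
  unfold rge
  simp only [rgeSample_eq]
  have h : ∀ (j : Fin b) (k : Fin n), Measurable fun q : Vec d × (Fin b → Ξ × (Fin n → Vec d)) =>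
      rgeDir F μr q.1 (q.2 j).1 ((q.2 j).2 k) := fun j k =>
    (measurable_rgeDir hW μr).comp
      (f := fun q : Vec d × (Fin b → Ξ × (Fin n → Vec d)) => (q.1, (q.2 j).1, (q.2 j).2 k))
      (by fun_prop)
  fun_prop

theorem measurable_rgeSample (hW : WellPosed F ν) (μr : ℝ) (n : ℕ) (x : Vec d) :
    Measurable fun q : Ξ × (Fin n → Vec d) => rgeSample F μr x q.1 q.2 := by
  simp only [rgeSample_eq]
  have h : ∀ k : Fin n, Measurable fun q : Ξ × (Fin n → Vec d) => rgeDir F μr x q.1 (q.2 k) :=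
    fun k => (measurable_rgeDir hW μr).comp
      (f := fun q : Ξ × (Fin n → Vec d) => (x, q.1, q.2 k)) (by fun_prop)
  fun_prop

/-- The bias in the direction `w`, for a fixed sample. The linearized estimator `rgeLin` is unbiased
because `d • E[u uᵀ]` is the identity. -/
theorem abs_integral_inner_rgeDir_sub_le (hd : 1 ≤ d) (hW : WellPosed F ν)
    (hF : LipschitzGrad F L) (hμ : 0 < μr) (x w : Vec d) (ξ : Ξ) :
    |∫ u, ⟪w, rgeDir F μr x ξ u⟫_ℝ ∂(sphereUnif d) - ⟪sampleGrad F x ξ, w⟫_ℝ|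
      ≤ ‖w‖ * (d * L * μr / 2) := by
  have := isProbabilityMeasure_sphereUnif hd
  have hm : Measurable (rgeDir F μr x ξ) := (measurable_rgeDir hW μr).comp
    (f := fun u => (x, ξ, u)) (by fun_prop)
  have hlin : ∫ u, ⟪w, rgeLin F x ξ u⟫_ℝ ∂(sphereUnif d) = ⟪sampleGrad F x ξ, w⟫_ℝ := by
    simp only [rgeLin, real_inner_smul_right, mul_assoc]
    rw [integral_const_mul, integral_inner_mul_inner_sphereUnif hd]
    field_simp
  have hlini : Integrable (rgeLin F x ξ) (sphereUnif d) :=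
    integrable_sphereUnif_of_bound hd (measurable_rgeLin x ξ).aestronglyMeasurable
      fun u hu => norm_rgeLin_le x ξ hu
  have hdiff : Integrable (fun u => rgeDir F μr x ξ u - rgeLin F x ξ u) (sphereUnif d) :=
    integrable_sphereUnif_of_bound hd (hm.sub (measurable_rgeLin x ξ)).aestronglyMeasurable
      fun u hu => norm_rgeDir_sub_rgeLin_le hF hμ x ξ hu
  have hdir : Integrable (rgeDir F μr x ξ) (sphereUnif d) := by
    refine (hdiff.add hlini).congr (ae_of_all _ fun u => ?_)
    simp
  rw [← hlin, ← integral_sub (hdir.const_inner w) (hlini.const_inner w)]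
  simp_rw [← inner_sub_right]
  have hb : ∀ᵐ u ∂(sphereUnif d), ‖⟪w, rgeDir F μr x ξ u - rgeLin F x ξ u⟫_ℝ‖
      ≤ ‖w‖ * (d * L * μr / 2) := ae_norm_sphereUnif.mono fun u hu =>
    (norm_inner_le_norm _ _).trans
      (by gcongr; exact norm_rgeDir_sub_rgeLin_le hF hμ x ξ hu)
  simpa using norm_integral_le_of_norm_le_const hb

theorem integrable_inner_rgeDir [IsProbabilityMeasure ν] (hd : 1 ≤ d) (hW : WellPosed F ν)
    (hF : LipschitzGrad F L) (hμ : 0 < μr) (x w : Vec d) :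
    Integrable (fun z : Ξ × Vec d => ⟪w, rgeDir F μr x z.1 z.2⟫_ℝ) (ν.prod (sphereUnif d)) := by
  have := isProbabilityMeasure_sphereUnif hd
  have hm : Measurable fun z : Ξ × Vec d => rgeDir F μr x z.1 z.2 := (measurable_rgeDir hW μr).comp
    (f := fun z : Ξ × Vec d => (x, z.1, z.2)) (by fun_prop)
  refine Integrable.const_inner w ?_
  refine Integrable.mono' (g := fun z : Ξ × Vec d => d * ‖sampleGrad F x z.1‖ + d * L * μr / 2)
    ?_ hm.aestronglyMeasurable ?_
  · exact (((integrable_sampleGrad hW hF x).norm.comp_fst _).const_mul _).add (integrable_const _)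
  · have h1 : ∀ᵐ z ∂(ν.prod (sphereUnif d)), ‖z.2‖ = 1 :=
      Measure.quasiMeasurePreserving_snd.ae ae_norm_sphereUnif
    filter_upwards [h1] with z hz
    calc ‖rgeDir F μr x z.1 z.2‖
        = ‖rgeLin F x z.1 z.2 + (rgeDir F μr x z.1 z.2 - rgeLin F x z.1 z.2)‖ := by
          rw [add_sub_cancel]
      _ ≤ _ := (norm_add_le _ _).trans
          (add_le_add (norm_rgeLin_le x z.1 hz) (norm_rgeDir_sub_rgeLin_le hF hμ x z.1 hz))

theorem abs_integral_prod_inner_rgeDir_sub_le [IsProbabilityMeasure ν] (hd : 1 ≤ d)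
    (hW : WellPosed F ν) (hF : LipschitzGrad F L) (hμ : 0 < μr) (x w : Vec d) :
    |∫ z, ⟪w, rgeDir F μr x z.1 z.2⟫_ℝ ∂(ν.prod (sphereUnif d))
      - ⟪gradient (objective F ν) x, w⟫_ℝ| ≤ ‖w‖ * (d * L * μr / 2) := by
  have := isProbabilityMeasure_sphereUnif hd
  have hi := integrable_inner_rgeDir hd hW hF hμ x w
  rw [integral_prod _ hi, ← integral_inner_sampleGrad hW hF,
    ← integral_sub hi.integral_prod_left (integrable_inner_sampleGrad hW hF x w)]
  simpa using norm_integral_le_of_norm_le_const (μ := ν)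
    (ae_of_all _ fun ξ => (Real.norm_eq_abs _).trans_le
      (abs_integral_inner_rgeDir_sub_le hd hW hF hμ x w ξ))

/-- The bias of the random gradient estimator. -/
theorem abs_integral_inner_rge_sub_le [IsProbabilityMeasure ν] {n b : ℕ} (hd : 1 ≤ d) (hn : 1 ≤ n)
    (hb : 1 ≤ b) (hW : WellPosed F ν) (hF : LipschitzGrad F L) (hμ : 0 < μr) (x w : Vec d) :
    |∫ B, ⟪w, rge F μr x B⟫_ℝ ∂(Measure.pi fun _ : Fin b =>
        ν.prod (Measure.pi fun _ : Fin n => sphereUnif d))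
      - ⟪gradient (objective F ν) x, w⟫_ℝ| ≤ ‖w‖ * (d * L * μr / 2) := by
  have := isProbabilityMeasure_sphereUnif hd
  have hp : ∀ k : Fin n, MeasurePreserving (fun z : Ξ × (Fin n → Vec d) => (z.1, z.2 k))
      (ν.prod (Measure.pi fun _ : Fin n => sphereUnif d)) (ν.prod (sphereUnif d)) := fun k =>
    (MeasurePreserving.id ν).prod (measurePreserving_eval (fun _ : Fin n => sphereUnif d) k)
  have hi := integrable_inner_rgeDir hd hW hF hμ x w
  have hik : ∀ k : Fin n, Integrable (fun z : Ξ × (Fin n → Vec d) =>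
      ⟪w, rgeDir F μr x z.1 (z.2 k)⟫_ℝ) (ν.prod (Measure.pi fun _ : Fin n => sphereUnif d)) :=
    fun k => (hp k).integrable_comp_of_integrable hi
  have hIk : ∀ k : Fin n, ∫ z, ⟪w, rgeDir F μr x z.1 (z.2 k)⟫_ℝ
      ∂(ν.prod (Measure.pi fun _ : Fin n => sphereUnif d))
      = ∫ z, ⟪w, rgeDir F μr x z.1 z.2⟫_ℝ ∂(ν.prod (sphereUnif d)) := fun k => by
    conv_rhs => rw [← (hp k).map_eq]
    rw [integral_map (hp k).aemeasurable (by rw [(hp k).map_eq]; exact hi.aestronglyMeasurable)]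
  have hsample : ∀ z : Ξ × (Fin n → Vec d), ⟪w, rgeSample F μr x z.1 z.2⟫_ℝ
      = (1 / (n : ℝ)) * ∑ k, ⟪w, rgeDir F μr x z.1 (z.2 k)⟫_ℝ := fun z => by
    rw [rgeSample_eq, real_inner_smul_right, inner_sum]
  have his : Integrable (fun z : Ξ × (Fin n → Vec d) => ⟪w, rgeSample F μr x z.1 z.2⟫_ℝ)
      (ν.prod (Measure.pi fun _ : Fin n => sphereUnif d)) := by
    simp only [hsample]
    exact (integrable_finsetSum _ fun k _ => hik k).const_mul _
  have hrge : ∀ B : Fin b → Ξ × (Fin n → Vec d), ⟪w, rge F μr x B⟫_ℝ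
      = (1 / (b : ℝ)) * ∑ j, ⟪w, rgeSample F μr x (B j).1 (B j).2⟫_ℝ := fun B => by
    rw [rge, real_inner_smul_right, inner_sum]
  simp only [hrge]
  rw [(integral_average hb his).2]
  simp only [hsample]
  rw [integral_const_mul, integral_finsetSum _ fun k _ => hik k]
  simp only [hIk, Finset.sum_const, Finset.card_univ, Fintype.card_fin, nsmul_eq_mul]
  rw [← mul_assoc, one_div, inv_mul_cancel₀ (by positivity), one_mul]
  exact abs_integral_prod_inner_rgeDir_sub_le hd hW hF hμ x w

/-- The second moment of a coordinate of the sample gradient: squared mean plus variance. -/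
theorem integral_sampleGrad_sq_le [IsProbabilityMeasure ν] {ζ : ℝ} (hW : WellPosed F ν)
    (hF : LipschitzGrad F L) (hV : CoordVarianceBound F ν ζ) (x : Vec d) (i : Fin d) :
    Integrable (fun ξ => sampleGrad F x ξ i ^ 2) ν ∧
    ∫ ξ, sampleGrad F x ξ i ^ 2 ∂ν ≤ gradient (objective F ν) x i ^ 2 + ζ ^ 2 := by
  have hi := integrable_sampleGrad_apply hW hF x i
  have hmean := integral_sampleGrad_apply hW hF x i
  set g := gradient (objective F ν) x i with hg
  have hexp : ∀ ξ, sampleGrad F x ξ i ^ 2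
      = (sampleGrad F x ξ i - g) ^ 2 + (2 * g * sampleGrad F x ξ i - g ^ 2) := fun ξ => by ring
  have h1 : Integrable (fun ξ => 2 * g * sampleGrad F x ξ i - g ^ 2) ν :=
    (hi.const_mul _).sub (integrable_const _)
  simp only [hexp]
  refine ⟨(hV.integrable x i).add h1, ?_⟩
  rw [integral_add (hV.integrable x i) h1, integral_sub (hi.const_mul _) (integrable_const _),
    integral_const_mul, hmean]
  simp only [integral_const, probReal_univ, one_smul]
  linarith [hV.bound x i]

theorem integral_norm_sampleGrad_sq_le [IsProbabilityMeasure ν] {ζ : ℝ} (hW : WellPosed F ν)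
    (hF : LipschitzGrad F L) (hV : CoordVarianceBound F ν ζ) (x : Vec d) :
    Integrable (fun ξ => ‖sampleGrad F x ξ‖ ^ 2) ν ∧
    ∫ ξ, ‖sampleGrad F x ξ‖ ^ 2 ∂ν ≤ ‖gradient (objective F ν) x‖ ^ 2 + d * ζ ^ 2 := by
  have h := integral_sampleGrad_sq_le hW hF hV x
  simp only [EuclideanSpace.real_norm_sq_eq]
  refine ⟨integrable_finsetSum _ fun i _ => (h i).1, ?_⟩
  rw [integral_finsetSum _ fun i _ => (h i).1]
  refine (Finset.sum_le_sum fun i _ => (h i).2).trans_eq ?_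
  simp [Finset.sum_add_distrib]

/-- The second moment of the random gradient estimator. -/
theorem lintegral_rge_sq_le [IsProbabilityMeasure ν] {ζ : ℝ} {n b : ℕ} (hd : 1 ≤ d) (hn : 1 ≤ n)
    (hW : WellPosed F ν) (hF : LipschitzGrad F L)
    (hV : CoordVarianceBound F ν ζ) (hμ : 0 < μr) (x : Vec d) :
    ∫⁻ B, ENNReal.ofReal (‖rge F μr x B‖ ^ 2) ∂(Measure.pi fun _ : Fin b =>
        ν.prod (Measure.pi fun _ : Fin n => sphereUnif d))
      ≤ ENNReal.ofReal (2 * (dnr d n * (‖gradient (objective F ν) x‖ ^ 2 + d * ζ ^ 2))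
        + 2 * (d * L * μr / 2) ^ 2) := by
  have := isProbabilityMeasure_sphereUnif hd
  have hm := measurable_rgeSample hW μr n x
  have hdnr : 0 ≤ dnr d n := by rw [dnr]; positivity
  refine (lintegral_average_sq_le (b := b)
    (φ := fun z : Ξ × (Fin n → Vec d) => rgeSample F μr x z.1 z.2) hm).trans ?_
  rw [lintegral_prod _ (by fun_prop)]
  refine (lintegral_mono fun ξ => lintegral_rgeSample_sq_le hd hn hF hμ x ξ).trans ?_
  obtain ⟨hi, hle⟩ := integral_norm_sampleGrad_sq_le hW hF hV x
  simpa only [mul_assoc] using lintegral_ofReal_affine_le (a := 2 * dnr d n) (by positivity)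
    (by positivity) hi (fun _ => by positivity) hle

end RGE

/-! ### Moments of the coordinate-wise gradient estimator -/

section CGE

variable {d : ℕ} {Ξ : Type*} {F : Vec d → Ξ → ℝ} {L μc : ℝ}

/-- The central difference quotient of the loss of one sample along `e_i`. -/
noncomputable def centralDiff (F : Vec d → Ξ → ℝ) (μc : ℝ) (x : Vec d) (i : Fin d) (ξ : Ξ) : ℝ :=
  (F (x + μc • basisVec i) ξ - F (x - μc • basisVec i) ξ) / (2 * μc)

/-- The mini-batch average of the central difference quotients along `e_i`. -/
noncomputable def batchDiff {b : ℕ} (F : Vec d → Ξ → ℝ) (μc : ℝ) (x : Vec d) (i : Fin d)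
    (B : Fin b → Ξ) : ℝ :=
  (1 / (b : ℝ)) * ∑ j, centralDiff F μc x i (B j)

theorem cge_apply {b : ℕ} (x : Vec d) (I : Finset (Fin d)) (p : Fin d → ℝ) (B : Fin b → Ξ)
    (i : Fin d) :
    cge F μc x I p B i = ((if i ∈ I then 1 else 0) / p i) * batchDiff F μc x i B := by
  have h : ∀ ξ, cgeSample F μc x I p ξ i
      = ((if i ∈ I then 1 else 0) / p i) * centralDiff F μc x i ξ := fun ξ => by
    simp [cgeSample, cgeCoord, centralDiff, WithLp.ofLp_sum, Finset.sum_apply, Pi.single_apply]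
  simp only [cge, PiLp.smul_apply, WithLp.ofLp_sum, Finset.sum_apply, h, batchDiff, smul_eq_mul,
    ← Finset.mul_sum]
  ring

theorem abs_centralDiff_sub_le (hF : LipschitzGrad F L) (hμ : 0 < μc) (x : Vec d) (i : Fin d)
    (ξ : Ξ) : |centralDiff F μc x i ξ - sampleGrad F x ξ i| ≤ L * μc / 2 := by
  have h1 := hF.taylor ξ x (μc • basisVec i)
  have h2 := hF.taylor ξ x (-(μc • basisVec i))
  rw [inner_neg_right] at h2
  simp only [norm_neg, norm_smul, PiLp.norm_single, real_inner_smul_right,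
    EuclideanSpace.inner_single_right, Real.norm_of_nonneg hμ.le] at h1 h2
  simp only [norm_one, mul_one, one_mul, conj_trivial, ← sub_eq_add_neg] at h1 h2
  have h3 : centralDiff F μc x i ξ - sampleGrad F x ξ i
      = 1 / (2 * μc) * (F (x + μc • basisVec i) ξ - F (x - μc • basisVec i) ξ
        - 2 * (μc * sampleGrad F x ξ i)) := by
    rw [centralDiff]
    field_simp
  have h4 : |F (x + μc • basisVec i) ξ - F (x - μc • basisVec i) ξ
      - 2 * (μc * sampleGrad F x ξ i)| ≤ L * μc ^ 2 := by
    rw [abs_le] at h1 h2 ⊢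
    constructor <;> linarith [h1.1, h1.2, h2.1, h2.2]
  rw [h3, abs_mul, abs_of_nonneg (by positivity)]
  calc 1 / (2 * μc) * _ ≤ 1 / (2 * μc) * (L * μc ^ 2) := by gcongr
    _ = _ := by field_simp

variable [MeasurableSpace Ξ] {ν : Measure Ξ}

theorem measurable_centralDiff (hW : WellPosed F ν) (μc : ℝ) (i : Fin d) :
    Measurable fun q : Vec d × Ξ => centralDiff F μc q.1 i q.2 := by
  have h1 : Measurable fun q : Vec d × Ξ => F (q.1 + μc • basisVec i) q.2 :=
    hW.measurable.comp (f := fun q : Vec d × Ξ => (q.1 + μc • basisVec i, q.2)) (by fun_prop)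
  have h2 : Measurable fun q : Vec d × Ξ => F (q.1 - μc • basisVec i) q.2 :=
    hW.measurable.comp (f := fun q : Vec d × Ξ => (q.1 - μc • basisVec i, q.2)) (by fun_prop)
  exact (h1.sub h2).div_const _

theorem measurable_batchDiff (hW : WellPosed F ν) (μc : ℝ) (b : ℕ) (i : Fin d) :
    Measurable fun q : Vec d × (Fin b → Ξ) => batchDiff F μc q.1 i q.2 := by
  refine Measurable.const_mul (Finset.measurable_sum _ fun j _ => ?_) _
  exact (measurable_centralDiff hW μc i).comp
    (f := fun q : Vec d × (Fin b → Ξ) => (q.1, q.2 j)) (by fun_prop)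

/-- The bias of the coordinate-wise gradient estimator. -/
theorem abs_integral_batchDiff_sub_le [IsProbabilityMeasure ν] {b : ℕ} (hb : 1 ≤ b)
    (hW : WellPosed F ν) (hF : LipschitzGrad F L) (hμ : 0 < μc) (x : Vec d) (i : Fin d) :
    |∫ B, batchDiff F μc x i B ∂(Measure.pi fun _ : Fin b => ν) - gradient (objective F ν) x i|
      ≤ L * μc / 2 := by
  have hi : Integrable (centralDiff F μc x i) ν :=
    ((hW.integrable _).sub (hW.integrable _)).div_const _
  unfold batchDiff
  rw [(integral_average hb hi).2, ← integral_sampleGrad_apply hW hF,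
    ← integral_sub hi (integrable_sampleGrad_apply hW hF x i)]
  simpa using norm_integral_le_of_norm_le_const (μ := ν)
    (ae_of_all _ fun ξ => (Real.norm_eq_abs _).trans_le (abs_centralDiff_sub_le hF hμ x i ξ))

/-- The second moment of the coordinate-wise gradient estimator. -/
theorem lintegral_batchDiff_sq_le [IsProbabilityMeasure ν] {ζ : ℝ} {b : ℕ}
    (hW : WellPosed F ν) (hF : LipschitzGrad F L) (hV : CoordVarianceBound F ν ζ) (hμ : 0 < μc)
    (x : Vec d) (i : Fin d) :
    ∫⁻ B, ENNReal.ofReal (batchDiff F μc x i B ^ 2) ∂(Measure.pi fun _ : Fin b => ν)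
      ≤ ENNReal.ofReal (2 * (gradient (objective F ν) x i ^ 2 + ζ ^ 2)
        + 2 * (L * μc / 2) ^ 2) := by
  have hm : Measurable (centralDiff F μc x i) := (measurable_centralDiff hW μc i).comp
    (f := fun ξ => (x, ξ)) (by fun_prop)
  have h := lintegral_average_sq_le (b := b) (ρ := ν) hm
  simp only [Real.norm_eq_abs, sq_abs, smul_eq_mul] at h
  refine h.trans ?_
  obtain ⟨hi, hle⟩ := integral_sampleGrad_sq_le hW hF hV x i
  have hpt : ∀ ξ, ENNReal.ofReal (centralDiff F μc x i ξ ^ 2)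
      ≤ ENNReal.ofReal (2 * sampleGrad F x ξ i ^ 2 + 2 * (L * μc / 2) ^ 2) := fun ξ => by
    refine ENNReal.ofReal_le_ofReal ?_
    have h1 := sq_le_sq' (abs_le.1 (abs_centralDiff_sub_le hF hμ x i ξ)).1
      (abs_le.1 (abs_centralDiff_sub_le hF hμ x i ξ)).2
    have h2 := add_sq_le (a := sampleGrad F x ξ i)
      (b := centralDiff F μc x i ξ - sampleGrad F x ξ i)
    rw [add_sub_cancel] at h2
    linarith
  refine (lintegral_mono hpt).trans ?_
  exact lintegral_ofReal_affine_le (by positivity) (by positivity) hi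
    (fun _ => by positivity) hle

end CGE

/-! ### Fresh randomness and selection events -/

section Probability

/-- A nonnegative function whose lower integral is bounded by that of an integrable function. -/
theorem integrable_and_integral_le_of_lintegral_le {Ω : Type*} [MeasurableSpace Ω]
    {P : Measure Ω} {φ ψ : Ω → ℝ} (hφ : Measurable φ)
    (hφ0 : ∀ ω, 0 ≤ φ ω) (hψ : Integrable ψ P) (hψ0 : ∀ᵐ ω ∂P, 0 ≤ ψ ω)
    (h : ∫⁻ ω, ENNReal.ofReal (φ ω) ∂P ≤ ∫⁻ ω, ENNReal.ofReal (ψ ω) ∂P) :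
    Integrable φ P ∧ ∫ ω, φ ω ∂P ≤ ∫ ω, ψ ω ∂P := by
  rw [← ofReal_integral_eq_lintegral_ofReal hψ hψ0] at h
  have hi : Integrable φ P := by
    refine ⟨hφ.aestronglyMeasurable, ?_⟩
    rw [hasFiniteIntegral_iff_ofReal (ae_of_all _ hφ0)]
    exact h.trans_lt ENNReal.ofReal_lt_top
  refine ⟨hi, ?_⟩
  rw [← ofReal_integral_eq_lintegral_ofReal hi (ae_of_all _ hφ0)] at h
  exact (ENNReal.ofReal_le_ofReal_iff (integral_nonneg_of_ae hψ0)).1 h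

variable {Ω S S' : Type*} {m mΩ : MeasurableSpace Ω} {P : Measure Ω} [IsProbabilityMeasure P]
  [MeasurableSpace S] [MeasurableSpace S']

theorem map_prodMk_of_indep (hm : m ≤ mΩ) {X : Ω → S} {Y : Ω → S'} (hX : Measurable[m] X)
    (hY : Measurable Y) (h : Indep (MeasurableSpace.comap Y inferInstance) m P) :
    P.map (fun ω => (X ω, Y ω)) = (P.map X).prod (P.map Y) := by
  have hXY : IndepFun X Y P := by
    rw [IndepFun_iff_Indep]
    exact indep_of_indep_of_le_left h.symm hX.comap_le
  exact (indepFun_iff_map_prod_eq_prod_map_map (hX.mono hm le_rfl).aemeasurable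
    hY.aemeasurable).1 hXY

/-- An expectation in which `Y` is independent of `X` is computed by averaging over `Y` first. -/
theorem lintegral_comp_of_indep (hm : m ≤ mΩ) {X : Ω → S} {Y : Ω → S'} (hX : Measurable[m] X)
    (hY : Measurable Y) (h : Indep (MeasurableSpace.comap Y inferInstance) m P)
    {φ : S × S' → ENNReal} (hφ : Measurable φ) :
    ∫⁻ ω, φ (X ω, Y ω) ∂P = ∫⁻ ω, ∫⁻ y, φ (X ω, y) ∂(P.map Y) ∂P := by
  have hX' : Measurable X := hX.mono hm le_rfl
  have hYp : IsProbabilityMeasure (P.map Y) := Measure.isProbabilityMeasure_map hY.aemeasurable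
  rw [← lintegral_map hφ (hX'.prodMk hY), map_prodMk_of_indep hm hX hY h,
    lintegral_prod _ hφ.aemeasurable, lintegral_map hφ.lintegral_prod_right' hX']

theorem integral_comp_of_indep (hm : m ≤ mΩ) {X : Ω → S} {Y : Ω → S'} (hX : Measurable[m] X)
    (hY : Measurable Y) (h : Indep (MeasurableSpace.comap Y inferInstance) m P)
    {φ : S × S' → ℝ} (hφ : Measurable φ) (hi : Integrable (fun ω => φ (X ω, Y ω)) P) :
    Integrable (fun ω => ∫ y, φ (X ω, y) ∂(P.map Y)) P ∧
    ∫ ω, φ (X ω, Y ω) ∂P = ∫ ω, ∫ y, φ (X ω, y) ∂(P.map Y) ∂P := by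
  have hX' : Measurable X := hX.mono hm le_rfl
  have hYp : IsProbabilityMeasure (P.map Y) := Measure.isProbabilityMeasure_map hY.aemeasurable
  have hXp : IsProbabilityMeasure (P.map X) := Measure.isProbabilityMeasure_map hX'.aemeasurable
  have hXY := hX'.prodMk hY
  have hi' : Integrable φ ((P.map X).prod (P.map Y)) := by
    rw [← map_prodMk_of_indep hm hX hY h]
    exact (integrable_map_measure hφ.aestronglyMeasurable hXY.aemeasurable).2 hi
  refine ⟨hi'.integral_prod_left.comp_measurable hX', ?_⟩
  rw [← integral_map (f := φ) hXY.aemeasurable hφ.aestronglyMeasurable,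
    map_prodMk_of_indep hm hX hY h, integral_prod _ hi',
    integral_map hX'.aemeasurable hi'.integral_prod_left.aestronglyMeasurable]

/-- If `A` has conditional probability `p` given `m`, then on nonnegative `m`-measurable functions
the restriction of `P` to `A` acts as the density `p`. -/
theorem setLIntegral_eq_of_condExp (hm : m ≤ mΩ) {A : Set Ω} (hA : MeasurableSet A) {p : Ω → ℝ}
    (hp : Measurable[m] p) (hp0 : ∀ᵐ ω ∂P, 0 ≤ p ω)
    (hAp : P[A.indicator (fun _ => (1 : ℝ)) | m] =ᵐ[P] p) {Y : Ω → ENNReal}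
    (hY : Measurable[m] Y) :
    ∫⁻ ω in A, Y ω ∂P = ∫⁻ ω, ENNReal.ofReal (p ω) * Y ω ∂P := by
  have hp' : Measurable p := hp.mono hm le_rfl
  have hpi : Integrable p P := integrable_condExp.congr hAp
  have hw : ∫⁻ ω, ENNReal.ofReal (p ω) * Y ω ∂P
      = ∫⁻ ω, Y ω ∂(P.withDensity fun ω => ENNReal.ofReal (p ω)) :=
    (lintegral_withDensity_eq_lintegral_mul P (by fun_prop) (hY.mono hm le_rfl)).symm
  rw [hw, ← lintegral_trim hm hY, ← lintegral_trim hm hY]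
  congr 1
  refine @Measure.ext _ m _ _ fun s hs => ?_
  have hs' : MeasurableSet s := hm s hs
  rw [trim_measurableSet_eq hm hs, trim_measurableSet_eq hm hs, Measure.restrict_apply hs',
    withDensity_apply _ hs',
    ← ofReal_integral_eq_lintegral_ofReal hpi.integrableOn (ae_restrict_of_ae hp0),
    ← setIntegral_congr_ae hs' (hAp.mono fun ω hω _ => hω),
    setIntegral_condExp hm ((integrable_const _).indicator hA) hs, setIntegral_indicator hA]
  simp [Measure.real]

theorem integral_indicator_mul_of_condExp (hm : m ≤ mΩ) {A : Set Ω} (hA : MeasurableSet A)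
    {p : Ω → ℝ} (hAp : P[A.indicator (fun _ => (1 : ℝ)) | m] =ᵐ[P] p) {Y : Ω → ℝ}
    (hY : Measurable[m] Y) (hYi : Integrable Y P) :
    ∫ ω, A.indicator (fun _ => (1 : ℝ)) ω * Y ω ∂P = ∫ ω, p ω * Y ω ∂P := by
  have h1 : Integrable (A.indicator (fun _ => (1 : ℝ))) P := (integrable_const _).indicator hA
  have h2 : Integrable (A.indicator (fun _ => (1 : ℝ)) * Y) P := by
    refine hYi.mono ((measurable_const.indicator hA).mul
      (hY.mono hm le_rfl)).aestronglyMeasurable (ae_of_all _ fun ω => ?_)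
    by_cases hω : ω ∈ A <;> simp [hω]
  have h3 := condExp_mul_of_stronglyMeasurable_right (m := m) hY.stronglyMeasurable h2 h1
  calc ∫ ω, A.indicator (fun _ => (1 : ℝ)) ω * Y ω ∂P
      = ∫ ω, (P[A.indicator (fun _ => (1 : ℝ)) * Y | m]) ω ∂P := (integral_condExp hm).symm
    _ = ∫ ω, p ω * Y ω ∂P := by
        refine integral_congr_ae ?_
        filter_upwards [h3, hAp] with ω h4 h5
        rw [h4, Pi.mul_apply, h5]

end Probability

/-! ### The filtration of a run -/

section Filtration

variable {d n : ℕ} {Ξ Ω : Type*} [MeasurableSpace Ξ]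

theorem measurableSet_mem_of_measurable {m : MeasurableSpace Ω} {I : Ω → Finset (Fin d)}
    (hI : @Measurable _ _ m ⊤ I) (i : Fin d) : MeasurableSet[m] {ω | i ∈ I ω} :=
  hI (show MeasurableSet[⊤] {s : Finset (Fin d) | i ∈ s} from trivial)

theorem measurable_rge_comp {m : MeasurableSpace Ω} {F : Vec d → Ξ → ℝ} {ν : Measure Ξ}
    (hW : WellPosed F ν) (μr : ℝ) {b : ℕ} {X : Ω → Vec d} {B : Ω → Fin b → Ξ × (Fin n → Vec d)}
    (hX : Measurable X) (hB : Measurable B) : Measurable fun ω => rge F μr (X ω) (B ω) := by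
  have h := (measurable_rge hW μr n b).comp (hX.prodMk hB)
  exact h

theorem measurable_batchDiff_comp {m : MeasurableSpace Ω} {F : Vec d → Ξ → ℝ} {ν : Measure Ξ}
    (hW : WellPosed F ν) (μc : ℝ) {b : ℕ} {X : Ω → Vec d} {B : Ω → Fin b → Ξ}
    (hX : Measurable X) (hB : Measurable B) (i : Fin d) :
    Measurable fun ω => batchDiff F μc (X ω) i (B ω) := by
  have h := (measurable_batchDiff hW μc b i).comp (hX.prodMk hB)
  exact h

theorem measurable_cge_comp {m : MeasurableSpace Ω} {F : Vec d → Ξ → ℝ} {ν : Measure Ξ}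
    (hW : WellPosed F ν) (μc : ℝ) {b : ℕ} {X : Ω → Vec d} {I : Ω → Finset (Fin d)}
    {p : Ω → Fin d → ℝ} {B : Ω → Fin b → Ξ} (hX : Measurable X) (hI : Measurable[m, ⊤] I)
    (hp : Measurable p) (hB : Measurable B) :
    Measurable fun ω => cge F μc (X ω) (I ω) (p ω) (B ω) := by
  have h2 : ∀ i, Measurable fun ω => if i ∈ I ω then (1 : ℝ) else 0 := fun i =>
    Measurable.ite (measurableSet_mem_of_measurable hI i) measurable_const measurable_const
  have h3 : ∀ i, Measurable fun ω => p ω i := fun i => (measurable_pi_apply i).comp hp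
  have h4 := measurable_batchDiff_comp hW μc hX hB
  have h : (fun ω => cge F μc (X ω) (I ω) (p ω) (B ω)) = fun ω =>
      WithLp.toLp 2 fun i => ((if i ∈ I ω then 1 else 0) / p ω i) * batchDiff F μc (X ω) i (B ω) := by
    ext ω i
    exact cge_apply _ _ _ _ _
  rw [h]
  exact (WithLp.measurable_toLp 2 _).comp
    (measurable_pi_lambda _ fun i => ((h2 i).div (h3 i)).mul (h4 i))

variable {D : Draws d Ξ Ω n}

namespace Draws

theorem history_mono {s t : ℕ} (h : s ≤ t) : D.history s ≤ D.history t :=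
  iSup_mono fun _ => iSup_le fun hr => le_iSup_of_le (hr.trans_le h) le_rfl

theorem beforeCoord_le_history_succ (t : ℕ) : D.beforeCoord t ≤ D.history (t + 1) := by
  have h : MeasurableSpace.comap (D.Br t) inferInstance ⊔ MeasurableSpace.comap (D.Bc t) inferInstance
      ⊔ MeasurableSpace.comap (D.I t) ⊤ ≤ D.history (t + 1) :=
    le_iSup₂_of_le t (Nat.lt_succ_self t) le_rfl
  exact sup_le (sup_le (history_mono (Nat.le_succ t))
    ((le_sup_left.trans le_sup_left).trans h)) ((le_sup_right.trans le_sup_left).trans h)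

theorem measurable_I_history_succ (t : ℕ) : Measurable[D.history (t + 1), ⊤] (D.I t) := by
  rw [measurable_iff_comap_le]
  exact le_sup_right.trans (le_iSup₂_of_le (f := fun s (_ : s < t + 1) =>
    MeasurableSpace.comap (D.Br s) inferInstance ⊔ MeasurableSpace.comap (D.Bc s) inferInstance
      ⊔ MeasurableSpace.comap (D.I s) ⊤) t (Nat.lt_succ_self t) le_rfl)

theorem measurable_Br_beforeCoord (t : ℕ) : Measurable[D.beforeCoord t] (D.Br t) := by
  rw [measurable_iff_comap_le]
  exact le_sup_right.trans le_sup_left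

theorem measurable_Bc_beforeCoord (t : ℕ) : Measurable[D.beforeCoord t] (D.Bc t) := by
  rw [measurable_iff_comap_le]
  exact le_sup_right

variable [mΩ : MeasurableSpace Ω] {ν : Measure Ξ} {P : Measure Ω} {T t : ℕ}

namespace IsZOHGD

theorem history_le (hD : D.IsZOHGD ν P T) (ht : t ≤ T) : D.history t ≤ mΩ :=
  iSup₂_le fun s hs => sup_le (sup_le (hD.measurable_Br s (hs.trans_le ht)).comap_le
    (hD.measurable_Bc s (hs.trans_le ht)).comap_le) (hD.measurable_I s (hs.trans_le ht)).comap_le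

theorem beforeCoord_le (hD : D.IsZOHGD ν P T) (ht : t < T) : D.beforeCoord t ≤ mΩ :=
  (beforeCoord_le_history_succ t).trans (hD.history_le ht)

theorem afterRGE_le (hD : D.IsZOHGD ν P T) (ht : t < T) : D.afterRGE t ≤ mΩ :=
  le_sup_left.trans (hD.beforeCoord_le ht)

theorem measurableSet_mem_I (hD : D.IsZOHGD ν P T) (ht : t < T) (i : Fin d) :
    MeasurableSet {ω | i ∈ D.I t ω} :=
  measurableSet_mem_of_measurable (hD.measurable_I t ht) i

theorem measurable_iterate (hD : D.IsZOHGD ν P T) {F : Vec d → Ξ → ℝ} (hW : WellPosed F ν)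
    (μr μc : ℝ) (η α : ℕ → ℝ) (x₀ : Vec d) (ht : t ≤ T) :
    Measurable[D.history t] (D.iterate F μr μc η α x₀ t) := by
  induction t with
  | zero => exact measurable_const
  | succ t ih =>
    have hX := (ih (Nat.le_of_succ_le ht)).mono (history_mono (Nat.le_succ t)) le_rfl
    have hBr := (measurable_Br_beforeCoord (D := D) t).mono (beforeCoord_le_history_succ t) le_rfl
    have hBc := (measurable_Bc_beforeCoord (D := D) t).mono (beforeCoord_le_history_succ t) le_rfl
    have hp := (hD.adapted_p t ht).mono
      (le_sup_left.trans (beforeCoord_le_history_succ t)) le_rfl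
    have h1 := (measurable_rge hW μr n (D.br t)).comp (hX.prodMk hBr)
    have h2 := measurable_cge_comp hW μc hX (measurable_I_history_succ t) hp hBc
    exact hX.sub (((h1.const_smul (α t)).add (h2.const_smul (1 - α t))).const_smul (η t))

end IsZOHGD

end Draws

end Filtration

/-! ### The estimators along a run -/

section Run

theorem sq_apply_le_norm_sq {d : ℕ} (v : Vec d) (i : Fin d) : v i ^ 2 ≤ ‖v‖ ^ 2 := by
  rw [EuclideanSpace.real_norm_sq_eq]
  exact Finset.single_le_sum (f := fun i => v i ^ 2) (fun _ _ => sq_nonneg _) (Finset.mem_univ i)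

theorem integrable_inner_of_sq {E Ω : Type*} [NormedAddCommGroup E] [InnerProductSpace ℝ E]
    [MeasurableSpace Ω] {P : Measure Ω} {U V : Ω → E}
    (hUV : AEStronglyMeasurable (fun ω => ⟪U ω, V ω⟫_ℝ) P)
    (hU : Integrable (fun ω => ‖U ω‖ ^ 2) P) (hV : Integrable (fun ω => ‖V ω‖ ^ 2) P) :
    Integrable (fun ω => ⟪U ω, V ω⟫_ℝ) P := by
  refine Integrable.mono' (hU.add hV) hUV
    (ae_of_all _ fun ω => (norm_inner_le_norm _ _).trans ?_)
  simp only [Pi.add_apply]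
  nlinarith [sq_nonneg (‖U ω‖ - ‖V ω‖), sq_nonneg ‖U ω‖, sq_nonneg ‖V ω‖]

theorem integrable_sum_one_div {d : ℕ} {Ω : Type*} [MeasurableSpace Ω] {P : Measure Ω}
    [IsFiniteMeasure P] {p : Ω → Fin d → ℝ} {c : ℝ} (hc : 0 < c) (hp : ∀ᵐ ω ∂P, ∀ i, c ≤ p ω i)
    (hpm : ∀ i, Measurable fun ω => p ω i) : Integrable (fun ω => ∑ i, 1 / p ω i) P := by
  refine integrable_finsetSum _ fun i _ => ?_
  refine Integrable.of_bound ((hpm i).const_div 1).aestronglyMeasurable (1 / c)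
    (hp.mono fun ω h => ?_)
  rw [Real.norm_of_nonneg (one_div_nonneg.2 (hc.le.trans (h i)))]
  exact one_div_le_one_div_of_le hc (h i)

variable {d n T t : ℕ} {Ξ Ω : Type*} [MeasurableSpace Ξ] [mΩ : MeasurableSpace Ω]
  {F : Vec d → Ξ → ℝ} {ν : Measure Ξ} [IsProbabilityMeasure ν] {P : Measure Ω}
  [IsProbabilityMeasure P] {D : Draws d Ξ Ω n} {L ζ μr μc c : ℝ} {X : Ω → Vec d}

/-- Second moment of the random gradient estimator at a point determined by the past. -/
theorem Draws.IsZOHGD.integral_rge_sq_le (hD : D.IsZOHGD ν P T) (hd : 1 ≤ d) (hn : 1 ≤ n)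
    (hW : WellPosed F ν) (hF : LipschitzGrad F L) (hV : CoordVarianceBound F ν ζ) (hμ : 0 < μr)
    (ht : t < T) (hX : Measurable[D.history t] X)
    (hG : Integrable (fun ω => ‖gradient (objective F ν) (X ω)‖ ^ 2) P) :
    Integrable (fun ω => ‖rge F μr (X ω) (D.Br t ω)‖ ^ 2) P ∧
    ∫ ω, ‖rge F μr (X ω) (D.Br t ω)‖ ^ 2 ∂P
      ≤ 2 * (dnr d n * (∫ ω, ‖gradient (objective F ν) (X ω)‖ ^ 2 ∂P + d * ζ ^ 2))
        + 2 * (d * L * μr / 2) ^ 2 := by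
  have hdnr : 0 ≤ dnr d n := by rw [dnr]; positivity
  have hm := hD.history_le ht.le
  have hrge := measurable_rge hW μr n (D.br t)
  have hψ : Integrable (fun ω => 2 * (dnr d n * (‖gradient (objective F ν) (X ω)‖ ^ 2 + d * ζ ^ 2))
        + 2 * (d * L * μr / 2) ^ 2) P :=
    (((hG.add (integrable_const _)).const_mul _).const_mul _).add (integrable_const _)
  have h := integrable_and_integral_le_of_lintegral_le
    (φ := fun ω => ‖rge F μr (X ω) (D.Br t ω)‖ ^ 2) (P := P)
    ((hrge.comp ((hX.mono hm le_rfl).prodMk (hD.measurable_Br t ht))).norm.pow_const 2)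
    (fun _ => by positivity) hψ (ae_of_all _ fun _ => by positivity) (by
      rw [lintegral_comp_of_indep hm hX (hD.measurable_Br t ht) (hD.indep_Br t ht)
        (φ := fun q => ENNReal.ofReal (‖rge F μr q.1 q.2‖ ^ 2)) (by fun_prop), hD.law_Br t ht]
      exact lintegral_mono fun ω => lintegral_rge_sq_le hd hn hW hF hV hμ (X ω))
  refine ⟨h.1, h.2.trans_eq ?_⟩
  have hexp : ∀ ω, 2 * (dnr d n * (‖gradient (objective F ν) (X ω)‖ ^ 2 + d * ζ ^ 2))
      + 2 * (d * L * μr / 2) ^ 2 = 2 * dnr d n * ‖gradient (objective F ν) (X ω)‖ ^ 2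
      + (2 * dnr d n * (d * ζ ^ 2) + 2 * (d * L * μr / 2) ^ 2) := fun ω => by ring
  simp only [hexp]
  rw [integral_add (hG.const_mul _) (integrable_const _), integral_const_mul]
  simp only [integral_const, probReal_univ, one_smul]
  ring

/-- The random gradient estimator is a descent direction on average, up to its bias. -/
theorem Draws.IsZOHGD.le_integral_inner_rge (hD : D.IsZOHGD ν P T) (hd : 1 ≤ d) (hn : 1 ≤ n)
    (hW : WellPosed F ν) (hF : LipschitzGrad F L) (hV : CoordVarianceBound F ν ζ) (hμ : 0 < μr)
    (ht : t < T) (hX : Measurable[D.history t] X)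
    (hG : Integrable (fun ω => ‖gradient (objective F ν) (X ω)‖ ^ 2) P) :
    (∫ ω, ‖gradient (objective F ν) (X ω)‖ ^ 2 ∂P) / 2 - (d * L * μr / 2) ^ 2 / 2
      ≤ ∫ ω, ⟪gradient (objective F ν) (X ω), rge F μr (X ω) (D.Br t ω)⟫_ℝ ∂P := by
  have hm := hD.history_le ht.le
  have hrge := measurable_rge hW μr n (D.br t)
  have hgm : Measurable (gradient (objective F ν)) := (continuous_gradient_objective hW hF).measurable
  have hX' : Measurable X := hX.mono hm le_rfl
  have hi := integrable_inner_of_sq ((hgm.comp hX').inner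
    (hrge.comp (hX'.prodMk (hD.measurable_Br t ht)))).aestronglyMeasurable hG
    (hD.integral_rge_sq_le hd hn hW hF hV hμ ht hX hG).1
  obtain ⟨h1, h2⟩ := integral_comp_of_indep hm hX (hD.measurable_Br t ht) (hD.indep_Br t ht)
    (φ := fun q => ⟪gradient (objective F ν) q.1, rge F μr q.1 q.2⟫_ℝ)
    ((hgm.comp measurable_fst).inner hrge) hi
  rw [h2]
  have hc : (d * L * μr / 2) ^ 2 / 2 = ∫ _ω, (d * L * μr / 2) ^ 2 / 2 ∂P := by simp
  rw [← integral_div, hc, ← integral_sub (hG.div_const 2) (integrable_const _)]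
  refine integral_mono ((hG.div_const 2).sub (integrable_const _)) h1 fun ω => ?_
  simp only [hD.law_Br t ht]
  have h := (abs_le.1 (abs_integral_inner_rge_sub_le (n := n) hd hn (hD.br_pos t ht) hW hF hμ (X ω)
    (gradient (objective F ν) (X ω)))).1
  rw [real_inner_self_eq_norm_sq] at h
  nlinarith [sq_nonneg (‖gradient (objective F ν) (X ω)‖ - d * L * μr / 2)]

theorem Draws.IsZOHGD.integrable_batchDiff_sq (hD : D.IsZOHGD ν P T)
    (hW : WellPosed F ν) (hF : LipschitzGrad F L) (hV : CoordVarianceBound F ν ζ) (hμ : 0 < μc)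
    (ht : t < T) (hX : Measurable[D.history t] X)
    (hG : Integrable (fun ω => ‖gradient (objective F ν) (X ω)‖ ^ 2) P) (i : Fin d) :
    Integrable (fun ω => batchDiff F μc (X ω) i (D.Bc t ω) ^ 2) P := by
  have hm := hD.afterRGE_le ht
  have hbd := measurable_batchDiff hW μc (D.bc t) i
  have hX2 : Measurable[D.afterRGE t] X := hX.mono le_sup_left le_rfl
  have hψ : Integrable (fun ω => 2 * (‖gradient (objective F ν) (X ω)‖ ^ 2 + ζ ^ 2)
        + 2 * (L * μc / 2) ^ 2) P :=
    ((hG.add (integrable_const _)).const_mul _).add (integrable_const _)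
  refine (integrable_and_integral_le_of_lintegral_le
    ((hbd.comp ((hX2.mono hm le_rfl).prodMk (hD.measurable_Bc t ht))).pow_const 2)
    (fun _ => by positivity) hψ (ae_of_all _ fun _ => by positivity) ?_).1
  have := lintegral_comp_of_indep hm hX2 (hD.measurable_Bc t ht) (hD.indep_Bc t ht)
    (φ := fun q => ENNReal.ofReal (batchDiff F μc q.1 i q.2 ^ 2)) (by fun_prop)
  simp only [Function.comp_apply]
  rw [this, hD.law_Bc t ht]
  refine lintegral_mono fun ω => (lintegral_batchDiff_sq_le hW hF hV hμ (X ω) i).trans ?_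
  refine ENNReal.ofReal_le_ofReal ?_
  have := sq_apply_le_norm_sq (gradient (objective F ν) (X ω)) i
  linarith

/-- Second moment of the coordinate-wise estimator: a coordinate that is selected with
probability `p` and then weighted by `1 / p` contributes `1 / p` times its second moment. -/
theorem Draws.IsZOHGD.integral_cge_sq_le (hD : D.IsZOHGD ν P T)
    (hW : WellPosed F ν) (hF : LipschitzGrad F L) (hV : CoordVarianceBound F ν ζ) (hμ : 0 < μc)
    (ht : t < T) (hX : Measurable[D.history t] X)
    (hG : Integrable (fun ω => ‖gradient (objective F ν) (X ω)‖ ^ 2) P)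
    (hc : 0 < c) (hp : ∀ᵐ ω ∂P, ∀ i, c ≤ D.p t ω i) :
    Integrable (fun ω => ‖cge F μc (X ω) (D.I t ω) (D.p t ω) (D.Bc t ω)‖ ^ 2) P ∧
    ∫ ω, ‖cge F μc (X ω) (D.I t ω) (D.p t ω) (D.Bc t ω)‖ ^ 2 ∂P
      ≤ 2 / c * ∫ ω, ‖gradient (objective F ν) (X ω)‖ ^ 2 ∂P
        + (2 * ζ ^ 2 + 2 * (L * μc / 2) ^ 2) * ∫ ω, ∑ i, 1 / D.p t ω i ∂P := by
  have hm := hD.beforeCoord_le ht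
  have hma := hD.afterRGE_le ht
  have hXa : Measurable[D.afterRGE t] X := hX.mono le_sup_left le_rfl
  have hX' : Measurable X := hXa.mono hma le_rfl
  have hpa : ∀ i, Measurable[D.afterRGE t] fun ω => D.p t ω i := fun i =>
    (measurable_pi_apply i).comp (hD.adapted_p t ht)
  have hbd := fun i => measurable_batchDiff hW μc (D.bc t) i
  have hgm : Measurable (gradient (objective F ν)) := (continuous_gradient_objective hW hF).measurable
  have hβ : ∀ i, Measurable[D.beforeCoord t] fun ω => batchDiff F μc (X ω) i (D.Bc t ω) :=
    measurable_batchDiff_comp hW μc (hXa.mono le_sup_left le_rfl)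
      (Draws.measurable_Bc_beforeCoord t)
  set e : ℝ := 2 * (L * μc / 2) ^ 2 with he
  have he0 : 0 ≤ e := by positivity
  have hnorm : ∀ ω, ENNReal.ofReal (‖cge F μc (X ω) (D.I t ω) (D.p t ω) (D.Bc t ω)‖ ^ 2)
      = ∑ i, {ω | i ∈ D.I t ω}.indicator (fun ω => ENNReal.ofReal
        ((batchDiff F μc (X ω) i (D.Bc t ω) / D.p t ω i) ^ 2)) ω := fun ω => by
    rw [EuclideanSpace.real_norm_sq_eq, ENNReal.ofReal_sum_of_nonneg fun _ _ => sq_nonneg _]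
    refine Finset.sum_congr rfl fun i _ => ?_
    rw [cge_apply]
    by_cases hi : i ∈ D.I t ω
    · simp only [hi, if_true, Set.mem_ofPred_eq, Set.indicator_of_mem]
      congr 2
      ring
    · simp [hi]
  have hquot : ∀ i, Measurable[D.beforeCoord t] fun ω =>
      ENNReal.ofReal ((batchDiff F μc (X ω) i (D.Bc t ω) / D.p t ω i) ^ 2) := fun i =>
    (((hβ i).div ((hpa i).mono le_sup_left le_rfl)).pow_const 2).ennreal_ofReal
  have hterm : ∀ i, ∫⁻ ω, {ω | i ∈ D.I t ω}.indicator (fun ω => ENNReal.ofReal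
        ((batchDiff F μc (X ω) i (D.Bc t ω) / D.p t ω i) ^ 2)) ω ∂P
      ≤ ∫⁻ ω, ENNReal.ofReal (1 / D.p t ω i) * ENNReal.ofReal
        (2 * (gradient (objective F ν) (X ω) i ^ 2 + ζ ^ 2) + e) ∂P := fun i => by
    rw [lintegral_indicator (hD.measurableSet_mem_I ht i),
      setLIntegral_eq_of_condExp hm (hD.measurableSet_mem_I ht i) ((hpa i).mono le_sup_left le_rfl)
        (hp.mono fun ω h => hc.le.trans (h i)) (hD.select t ht i)
        (hquot i)]
    have hpt : ∀ᵐ ω ∂P, ENNReal.ofReal (D.p t ω i) * ENNReal.ofReal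
        ((batchDiff F μc (X ω) i (D.Bc t ω) / D.p t ω i) ^ 2)
        = ENNReal.ofReal (1 / D.p t ω i) * ENNReal.ofReal
          (batchDiff F μc (X ω) i (D.Bc t ω) ^ 2) := hp.mono fun ω h => by
      have h0 : 0 < D.p t ω i := hc.trans_le (h i)
      rw [← ENNReal.ofReal_mul h0.le, ← ENNReal.ofReal_mul (by positivity)]
      congr 1
      field_simp
    rw [lintegral_congr_ae hpt]
    have hm1 : Measurable fun q : (Vec d × ℝ) × (Fin (D.bc t) → Ξ) =>
        ENNReal.ofReal (batchDiff F μc q.1.1 i q.2 ^ 2) :=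
      (((hbd i).comp (f := fun q : (Vec d × ℝ) × (Fin (D.bc t) → Ξ) => (q.1.1, q.2))
        (by fun_prop)).pow_const 2).ennreal_ofReal
    have hm2 : Measurable fun q : (Vec d × ℝ) × (Fin (D.bc t) → Ξ) =>
        ENNReal.ofReal (1 / q.1.2) := by fun_prop
    have h := lintegral_comp_of_indep hma (hXa.prodMk (hpa i)) (hD.measurable_Bc t ht)
      (hD.indep_Bc t ht) (hm2.mul hm1)
    simp only [Pi.mul_apply] at h
    rw [h, hD.law_Bc t ht]
    refine lintegral_mono fun ω => ?_
    rw [lintegral_const_mul' _ _ ENNReal.ofReal_ne_top]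
    gcongr
    exact lintegral_batchDiff_sq_le hW hF hV hμ (X ω) i
  have hS := integrable_sum_one_div hc hp (fun i => (hpa i).mono hma le_rfl)
  have hψ : Integrable (fun ω => 2 / c * ‖gradient (objective F ν) (X ω)‖ ^ 2
      + (2 * ζ ^ 2 + e) * ∑ i, 1 / D.p t ω i) P := (hG.const_mul _).add (hS.const_mul _)
  have hcge : Measurable fun ω => cge F μc (X ω) (D.I t ω) (D.p t ω) (D.Bc t ω) :=
    measurable_cge_comp hW μc hX' (hD.measurable_I t ht) ((hD.adapted_p t ht).mono hma le_rfl)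
      (hD.measurable_Bc t ht)
  have h := integrable_and_integral_le_of_lintegral_le (P := P) (hcge.norm.pow_const 2)
    (fun _ => by positivity) hψ (hp.mono fun ω h => by
      have : ∀ i, 0 < D.p t ω i := fun i => hc.trans_le (h i)
      have : 0 ≤ ∑ i, 1 / D.p t ω i := Finset.sum_nonneg fun i _ => (one_div_pos.2 (this i)).le
      positivity) (by
      simp only [hnorm]
      rw [lintegral_finsetSum _ fun i _ => ((hquot i).mono hm le_rfl).indicator
        (hD.measurableSet_mem_I ht i)]
      refine (Finset.sum_le_sum fun i _ => hterm i).trans ?_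
      have hgi : ∀ i, Measurable fun ω => gradient (objective F ν) (X ω) i := fun i =>
        (measurable_pi_apply i).comp ((WithLp.measurable_ofLp 2 _).comp (hgm.comp hX'))
      have hprod : ∀ i, Measurable fun ω => ENNReal.ofReal (1 / D.p t ω i) * ENNReal.ofReal
          (2 * (gradient (objective F ν) (X ω) i ^ 2 + ζ ^ 2) + e) := fun i =>
        (((hpa i).mono hma le_rfl).const_div 1).ennreal_ofReal.mul
          (((((hgi i).pow_const 2).add_const _).const_mul _).add_const _).ennreal_ofReal
      rw [← lintegral_finsetSum _ fun i _ => hprod i]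
      refine lintegral_mono_ae (hp.mono fun ω h => ?_)
      have hp0 : ∀ i, 0 < D.p t ω i := fun i => hc.trans_le (h i)
      have hp1 : ∀ i, 0 ≤ 1 / D.p t ω i := fun i => (one_div_pos.2 (hp0 i)).le
      simp only [← ENNReal.ofReal_mul (hp1 _)]
      rw [← ENNReal.ofReal_sum_of_nonneg fun i _ => mul_nonneg (hp1 i) (by positivity)]
      refine ENNReal.ofReal_le_ofReal ?_
      rw [EuclideanSpace.real_norm_sq_eq, Finset.mul_sum, Finset.mul_sum, ← Finset.sum_add_distrib]
      refine Finset.sum_le_sum fun i _ => ?_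
      have h2 : 1 / D.p t ω i ≤ 1 / c := one_div_le_one_div_of_le hc (h i)
      calc 1 / D.p t ω i * (2 * (gradient (objective F ν) (X ω) i ^ 2 + ζ ^ 2) + e)
          = 1 / D.p t ω i * (2 * gradient (objective F ν) (X ω) i ^ 2)
            + (2 * ζ ^ 2 + e) * (1 / D.p t ω i) := by ring
        _ ≤ 1 / c * (2 * gradient (objective F ν) (X ω) i ^ 2)
            + (2 * ζ ^ 2 + e) * (1 / D.p t ω i) := by gcongr
        _ = _ := by ring)
  refine ⟨h.1, h.2.trans_eq ?_⟩
  rw [integral_add (hG.const_mul _) (hS.const_mul _), integral_const_mul, integral_const_mul]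

/-- The coordinate-wise estimator is a descent direction on average, up to its bias: the selection
probability cancels the weight `1 / p`. -/
theorem Draws.IsZOHGD.le_integral_inner_cge (hD : D.IsZOHGD ν P T)
    (hW : WellPosed F ν) (hF : LipschitzGrad F L) (hV : CoordVarianceBound F ν ζ) (hμ : 0 < μc)
    (ht : t < T) (hX : Measurable[D.history t] X)
    (hG : Integrable (fun ω => ‖gradient (objective F ν) (X ω)‖ ^ 2) P)
    (hc : 0 < c) (hp : ∀ᵐ ω ∂P, ∀ i, c ≤ D.p t ω i) :
    (∫ ω, ‖gradient (objective F ν) (X ω)‖ ^ 2 ∂P) / 2 - d * (L * μc / 2) ^ 2 / 2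
      ≤ ∫ ω, ⟪gradient (objective F ν) (X ω),
          cge F μc (X ω) (D.I t ω) (D.p t ω) (D.Bc t ω)⟫_ℝ ∂P := by
  have hm := hD.beforeCoord_le ht
  have hma := hD.afterRGE_le ht
  have hXa : Measurable[D.afterRGE t] X := hX.mono le_sup_left le_rfl
  have hXb : Measurable[D.beforeCoord t] X := hXa.mono le_sup_left le_rfl
  have hX' : Measurable X := hXa.mono hma le_rfl
  have hpb : ∀ i, Measurable[D.beforeCoord t] fun ω => D.p t ω i := fun i =>
    (measurable_pi_apply i).comp ((hD.adapted_p t ht).mono le_sup_left le_rfl)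
  have hbd := fun i => measurable_batchDiff hW μc (D.bc t) i
  have hgm : Measurable (gradient (objective F ν)) := (continuous_gradient_objective hW hF).measurable
  have hgim : ∀ i, Measurable fun x => gradient (objective F ν) x i := fun i =>
    (measurable_pi_apply i).comp ((WithLp.measurable_ofLp 2 _).comp hgm)
  have hβ : ∀ i, Measurable[D.beforeCoord t] fun ω => batchDiff F μc (X ω) i (D.Bc t ω) :=
    measurable_batchDiff_comp hW μc hXb (Draws.measurable_Bc_beforeCoord t)
  have hgi2 : ∀ i, Integrable (fun ω => gradient (objective F ν) (X ω) i ^ 2) P := fun i =>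
    hG.mono' (((hgim i).comp hX').pow_const 2).aestronglyMeasurable (ae_of_all _ fun ω => by
      rw [Real.norm_of_nonneg (sq_nonneg _)]
      exact sq_apply_le_norm_sq _ i)
  have hβ2 := fun i => hD.integrable_batchDiff_sq hW hF hV hμ ht hX hG i
  have hgβ : ∀ i, Integrable (fun ω => gradient (objective F ν) (X ω) i
      * batchDiff F μc (X ω) i (D.Bc t ω)) P := fun i => by
    refine Integrable.mono' ((hgi2 i).add (hβ2 i)) (((hgim i).comp hX').mul
      ((hβ i).mono hm le_rfl)).aestronglyMeasurable (ae_of_all _ fun ω => ?_)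
    rw [Real.norm_eq_abs, abs_le]
    simp only [Pi.add_apply]
    constructor <;> nlinarith [sq_nonneg (gradient (objective F ν) (X ω) i
      + batchDiff F μc (X ω) i (D.Bc t ω)), sq_nonneg (gradient (objective F ν) (X ω) i
      - batchDiff F μc (X ω) i (D.Bc t ω)), sq_nonneg (gradient (objective F ν) (X ω) i),
      sq_nonneg (batchDiff F μc (X ω) i (D.Bc t ω))]
  have hYm : ∀ i, Measurable[D.beforeCoord t] fun ω => gradient (objective F ν) (X ω) i
      * batchDiff F μc (X ω) i (D.Bc t ω) / D.p t ω i := fun i =>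
    (((hgim i).comp hXb).mul (hβ i)).div (hpb i)
  have hYi : ∀ i, Integrable (fun ω => gradient (objective F ν) (X ω) i
      * batchDiff F μc (X ω) i (D.Bc t ω) / D.p t ω i) P := fun i => by
    refine Integrable.mono' ((hgβ i).norm.const_mul (1 / c))
      ((hYm i).mono hm le_rfl).aestronglyMeasurable (hp.mono fun ω h => ?_)
    rw [norm_div, Real.norm_of_nonneg (hc.le.trans (h i)), div_eq_inv_mul, one_div]
    gcongr
    exact h i
  have hinner : ∀ ω, ⟪gradient (objective F ν) (X ω),
      cge F μc (X ω) (D.I t ω) (D.p t ω) (D.Bc t ω)⟫_ℝ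
      = ∑ i, {ω | i ∈ D.I t ω}.indicator (fun _ => (1 : ℝ)) ω * (gradient (objective F ν) (X ω) i
      * batchDiff F μc (X ω) i (D.Bc t ω) / D.p t ω i) := fun ω => by
    rw [PiLp.inner_apply]
    refine Finset.sum_congr rfl fun i _ => ?_
    rw [cge_apply]
    by_cases hi : i ∈ D.I t ω
    · simp [hi]
      ring
    · simp [hi]
  have hterm : ∀ i, ∫ ω, {ω | i ∈ D.I t ω}.indicator (fun _ => (1 : ℝ)) ω
      * (gradient (objective F ν) (X ω) i
        * batchDiff F μc (X ω) i (D.Bc t ω) / D.p t ω i) ∂P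
      = ∫ ω, gradient (objective F ν) (X ω) i * batchDiff F μc (X ω) i (D.Bc t ω) ∂P := fun i => by
    rw [integral_indicator_mul_of_condExp hm (hD.measurableSet_mem_I ht i) (hD.select t ht i)
      (hYm i) (hYi i)]
    refine integral_congr_ae (hp.mono fun ω h => ?_)
    have h0 : D.p t ω i ≠ 0 := (hc.trans_le (h i)).ne'
    simp only
    field_simp
  have hterm2 : ∀ i, (∫ ω, gradient (objective F ν) (X ω) i ^ 2 ∂P) / 2 - (L * μc / 2) ^ 2 / 2
      ≤ ∫ ω, gradient (objective F ν) (X ω) i * batchDiff F μc (X ω) i (D.Bc t ω) ∂P := fun i => by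
    obtain ⟨h1, h2⟩ := integral_comp_of_indep hma hXa (hD.measurable_Bc t ht) (hD.indep_Bc t ht)
      (φ := fun q => gradient (objective F ν) q.1 i * batchDiff F μc q.1 i q.2)
      (((hgim i).comp measurable_fst).mul (hbd i)) (hgβ i)
    rw [h2]
    have hcst : (L * μc / 2) ^ 2 / 2 = ∫ _ω, (L * μc / 2) ^ 2 / 2 ∂P := by simp
    rw [← integral_div, hcst, ← integral_sub ((hgi2 i).div_const 2) (integrable_const _)]
    refine integral_mono (((hgi2 i).div_const 2).sub (integrable_const _)) h1 fun ω => ?_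
    simp only [hD.law_Bc t ht]
    rw [integral_const_mul]
    have h := abs_le.1 (abs_integral_batchDiff_sub_le (hD.bc_pos t ht) hW hF hμ (X ω) i)
    set y := ∫ B, batchDiff F μc (X ω) i B ∂(Measure.pi fun _ : Fin (D.bc t) => ν)
    set g := gradient (objective F ν) (X ω) i
    have h3 : (y - g) ^ 2 ≤ (L * μc / 2) ^ 2 := sq_le_sq' h.1 h.2
    nlinarith [sq_nonneg y]
  have hind : ∀ i, Integrable (fun ω => {ω | i ∈ D.I t ω}.indicator (fun _ => (1 : ℝ)) ω
      * (gradient (objective F ν) (X ω) i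
        * batchDiff F μc (X ω) i (D.Bc t ω) / D.p t ω i)) P := fun i => by
    refine (hYi i).mono ((measurable_const.indicator (hD.measurableSet_mem_I ht i)).mul
      ((hYm i).mono hm le_rfl)).aestronglyMeasurable (ae_of_all _ fun ω => ?_)
    by_cases hω : i ∈ D.I t ω
    · simp [hω]
    · simp only [hω, Set.mem_ofPred_eq, not_false_eq_true, Set.indicator_of_notMem, zero_mul,
        norm_zero]
      exact norm_nonneg _
  simp only [hinner]
  rw [integral_finsetSum _ fun i _ => hind i]
  simp only [hterm]
  refine le_trans (le_of_eq ?_) (Finset.sum_le_sum fun i _ => hterm2 i)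
  simp only [EuclideanSpace.real_norm_sq_eq]
  rw [integral_finsetSum _ fun i _ => hgi2 i, Finset.sum_sub_distrib, ← Finset.sum_div]
  simp
  ring

end Run

/-! ### Expected descent -/

/-- The descent inequality after inserting the moment bounds of the two estimators; `G` is the mean
squared gradient norm, `S` the mean sum of the inverse selection probabilities, `R₂`, `C₂`, `H₂` are
the second moments and `Rₗ`, `Cₗ` the mean inner products with the gradient. -/
theorem descent_step_bound {d n : ℕ} {L ζ δ η α c μc G S R₂ C₂ H₂ Rₗ Cₗ f₀ : ℝ} (hd : 1 ≤ d)
    (hL : 0 ≤ L) (hη : 0 ≤ η) (hc : 0 < c) (hα0 : 0 ≤ α) (hα1 : α ≤ 1) (hG0 : 0 ≤ G) (hS0 : 0 ≤ S)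
    (hηc : L * η ≤ c / 8) (hηd : L * η * dnr d n ≤ 1 / 24)
    (hδc : d * (L * μc) ^ 2 = δ ^ 2) (hδ : δ ^ 2 ≤ d * ζ ^ 2)
    (hR2 : R₂ ≤ 2 * (dnr d n * (G + d * ζ ^ 2)) + 2 * δ ^ 2)
    (hC2 : C₂ ≤ 2 / c * G + (2 * ζ ^ 2 + 2 * (L * μc / 2) ^ 2) * S)
    (hIR : G / 2 - δ ^ 2 / 2 ≤ Rₗ) (hIC : G / 2 - d * (L * μc / 2) ^ 2 / 2 ≤ Cₗ)
    (hH2 : H₂ ≤ 2 * α ^ 2 * R₂ + 2 * (1 - α) ^ 2 * C₂) :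
    f₀ - η * (α * Rₗ + (1 - α) * Cₗ) + L / 2 * η ^ 2 * H₂
      ≤ f₀ - η / 4 * G + (η / 2 * δ ^ 2 + L * η ^ 2 * (4 * α ^ 2 * dnr d n * (d * ζ ^ 2)
          + 5 / 2 * (1 - α) ^ 2 * ζ ^ 2 * S)) := by
  have hd0 : (0 : ℝ) < d := by exact_mod_cast hd
  have hdnr : 1 ≤ dnr d n := by
    rw [dnr]
    linarith [show (0 : ℝ) ≤ d / n by positivity]
  -- The second moments, with the smoothing errors absorbed into the variance.
  have hR3 : R₂ ≤ 2 * dnr d n * G + 4 * dnr d n * (d * ζ ^ 2) := by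
    have : 1 * (d * ζ ^ 2) ≤ dnr d n * (d * ζ ^ 2) := by gcongr
    linarith
  have hζ : (L * μc) ^ 2 ≤ ζ ^ 2 := le_of_mul_le_mul_left (hδc.trans_le hδ) hd0
  have hC3 : C₂ ≤ 2 / c * G + 5 / 2 * ζ ^ 2 * S := by
    refine hC2.trans ?_
    gcongr
    linarith
  have hIC3 : G / 2 - δ ^ 2 / 2 ≤ Cₗ := by
    have : d * (L * μc / 2) ^ 2 = δ ^ 2 / 4 := by rw [← hδc]; ring
    linarith [sq_nonneg δ]
  have hI : G / 2 - δ ^ 2 / 2 ≤ α * Rₗ + (1 - α) * Cₗ := by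
    have := mul_le_mul_of_nonneg_left hIR hα0
    have := mul_le_mul_of_nonneg_left hIC3 (sub_nonneg.2 hα1)
    linarith
  have hH3 : H₂ ≤ 2 * α ^ 2 * (2 * dnr d n * G + 4 * dnr d n * (d * ζ ^ 2))
        + 2 * (1 - α) ^ 2 * (2 / c * G + 5 / 2 * ζ ^ 2 * S) := by
    refine hH2.trans ?_
    gcongr
  -- This is where the bound on the step size enters.
  have hcoef : L * η * (2 * α ^ 2 * dnr d n + 2 * (1 - α) ^ 2 / c) ≤ 1 / 4 := by
    have h4 : L * η / c ≤ 1 / 8 := by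
      rw [div_le_iff₀ hc]
      linarith
    have h5 : α ^ 2 * (L * η * dnr d n) ≤ α ^ 2 * (1 / 24) := by gcongr
    have h6 : (1 - α) ^ 2 * (L * η / c) ≤ (1 - α) ^ 2 * (1 / 8) := by gcongr
    have h7 : 0 ≤ α * (1 - α) := mul_nonneg hα0 (sub_nonneg.2 hα1)
    calc L * η * (2 * α ^ 2 * dnr d n + 2 * (1 - α) ^ 2 / c)
        = 2 * (α ^ 2 * (L * η * dnr d n)) + 2 * ((1 - α) ^ 2 * (L * η / c)) := by ring
      _ ≤ 1 / 4 := by linarith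
  have h7 := mul_le_mul_of_nonneg_left hI hη
  have h8 := mul_le_mul_of_nonneg_left hH3 (show 0 ≤ L / 2 * η ^ 2 by positivity)
  have h9 := mul_le_mul_of_nonneg_left hcoef (mul_nonneg hη hG0)
  calc f₀ - η * (α * Rₗ + (1 - α) * Cₗ) + L / 2 * η ^ 2 * H₂
      ≤ f₀ - η * (G / 2 - δ ^ 2 / 2)
        + L / 2 * η ^ 2 * (2 * α ^ 2 * (2 * dnr d n * G + 4 * dnr d n * (d * ζ ^ 2))
        + 2 * (1 - α) ^ 2 * (2 / c * G + 5 / 2 * ζ ^ 2 * S)) := by linarith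
    _ = f₀ - η * (G / 2 - δ ^ 2 / 2)
        + η * G * (L * η * (2 * α ^ 2 * dnr d n + 2 * (1 - α) ^ 2 / c))
        + L * η ^ 2 * (4 * α ^ 2 * dnr d n * (d * ζ ^ 2) + 5 / 2 * (1 - α) ^ 2 * ζ ^ 2 * S) := by
        ring
    _ ≤ _ := by linarith

section Descent

variable {d n T t : ℕ} {Ξ Ω : Type*} [MeasurableSpace Ξ] [mΩ : MeasurableSpace Ω]
  {F : Vec d → Ξ → ℝ} {ν : Measure Ξ} [IsProbabilityMeasure ν] {P : Measure Ω}
  {L : ℝ}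

/-- The descent lemma in expectation, along a random direction `H`. -/
theorem integral_objective_sub_smul_le (hW : WellPosed F ν) (hF : LipschitzGrad F L)
    {X H : Ω → Vec d} (hX : Measurable X) (hH : Measurable H) (η : ℝ)
    (hf : Integrable (fun ω => objective F ν (X ω)) P)
    (hG : Integrable (fun ω => ‖gradient (objective F ν) (X ω)‖ ^ 2) P)
    (hH2 : Integrable (fun ω => ‖H ω‖ ^ 2) P) :
    Integrable (fun ω => objective F ν (X ω - η • H ω)) P ∧
    Integrable (fun ω => ‖gradient (objective F ν) (X ω - η • H ω)‖ ^ 2) P ∧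
    ∫ ω, objective F ν (X ω - η • H ω) ∂P ≤ ∫ ω, objective F ν (X ω) ∂P
      - η * ∫ ω, ⟪gradient (objective F ν) (X ω), H ω⟫_ℝ ∂P + L / 2 * η ^ 2 * ∫ ω, ‖H ω‖ ^ 2 ∂P := by
  have hgm : Measurable (gradient (objective F ν)) :=
    (continuous_gradient_objective hW hF).measurable
  have hfm : Measurable (objective F ν) := (differentiable_objective hW hF).continuous.measurable
  have hX' : Measurable fun ω => X ω - η • H ω := hX.sub (hH.const_smul η)
  have hip : Integrable (fun ω => ⟪gradient (objective F ν) (X ω), H ω⟫_ℝ) P :=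
    integrable_inner_of_sq ((hgm.comp hX).inner hH).aestronglyMeasurable hG hH2
  have htay : ∀ ω, |objective F ν (X ω - η • H ω) - objective F ν (X ω)
      + η * ⟪gradient (objective F ν) (X ω), H ω⟫_ℝ| ≤ L / 2 * η ^ 2 * ‖H ω‖ ^ 2 := fun ω => by
    have h := objective_taylor hW hF (X ω) (-(η • H ω))
    rw [inner_neg_right, real_inner_smul_right, norm_neg, norm_smul, mul_pow, Real.norm_eq_abs,
      sq_abs, sub_neg_eq_add, ← sub_eq_add_neg] at h
    linarith
  have hlin : Integrable (fun ω => objective F ν (X ω)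
      - η * ⟪gradient (objective F ν) (X ω), H ω⟫_ℝ) P := hf.sub (hip.const_mul η)
  have hquad : Integrable (fun ω => L / 2 * η ^ 2 * ‖H ω‖ ^ 2) P := hH2.const_mul _
  have hf' : Integrable (fun ω => objective F ν (X ω - η • H ω)) P := by
    refine Integrable.mono' (hlin.norm.add hquad)
      (hfm.comp hX').aestronglyMeasurable (ae_of_all _ fun ω => ?_)
    have h1 := htay ω
    simp only [Pi.add_apply]
    have h2 := abs_sub_abs_le_abs_sub (objective F ν (X ω - η • H ω)) (objective F ν (X ω)
      - η * ⟪gradient (objective F ν) (X ω), H ω⟫_ℝ)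
    rw [← sub_add] at h2
    simp only [Real.norm_eq_abs]
    linarith
  refine ⟨hf', ?_, ?_⟩
  · refine Integrable.mono' ((hG.const_mul 2).add (hH2.const_mul (2 * (L * η) ^ 2)))
      ((hgm.comp hX').norm.pow_const 2).aestronglyMeasurable (ae_of_all _ fun ω => ?_)
    rw [Real.norm_of_nonneg (sq_nonneg _)]
    have h1 := lipschitz_gradient_objective hW hF (X ω - η • H ω) (X ω)
    rw [sub_sub_cancel_left, norm_neg, norm_smul, Real.norm_eq_abs] at h1
    have h2 := norm_sub_norm_le (gradient (objective F ν) (X ω - η • H ω))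
      (gradient (objective F ν) (X ω))
    have h3 : ‖gradient (objective F ν) (X ω - η • H ω)‖
        ≤ ‖gradient (objective F ν) (X ω)‖ + L * (|η| * ‖H ω‖) := by linarith
    simp only [Pi.add_apply]
    calc ‖gradient (objective F ν) (X ω - η • H ω)‖ ^ 2
        ≤ (‖gradient (objective F ν) (X ω)‖ + L * (|η| * ‖H ω‖)) ^ 2 := by gcongr
      _ ≤ 2 * (‖gradient (objective F ν) (X ω)‖ ^ 2 + (L * (|η| * ‖H ω‖)) ^ 2) := add_sq_le
      _ = _ := by rw [mul_pow, mul_pow, sq_abs]; ring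
  · rw [← integral_const_mul, ← integral_const_mul, ← integral_sub hf (hip.const_mul η),
      ← integral_add hlin hquad]
    refine integral_mono hf' (hlin.add hquad) fun ω => ?_
    have := (abs_le.1 (htay ω)).2
    simp only
    linarith

variable [IsProbabilityMeasure P] {D : Draws d Ξ Ω n} {ζ δ μr μc η α c : ℝ} {x₀ : Vec d}

/-- One step of the algorithm. The step size makes the `‖∇f‖²`-part of the second moment of the
estimator at most half of the gain `η ‖∇f‖² / 2` of the descent lemma. Here `δ` is the common bound
of the biases of the two estimators. -/
theorem Draws.IsZOHGD.integral_objective_iterate_succ_le (hD : D.IsZOHGD ν P T) (hd : 1 ≤ d)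
    (hn : 1 ≤ n) (hL : 0 < L) (hW : WellPosed F ν) (hF : LipschitzGrad F L)
    (hV : CoordVarianceBound F ν ζ) (hμr : 0 < μr) (hμc : 0 < μc) (hδr : d * L * μr / 2 = δ)
    (hδc : d * (L * μc) ^ 2 = δ ^ 2) (hδ : δ ^ 2 ≤ d * ζ ^ 2) (ht : t < T)
    (hc : 0 < c) (hp : ∀ᵐ ω ∂P, ∀ i, c ≤ D.p t ω i) (hη : 0 ≤ η) (hηc : L * η ≤ c / 8)
    (hηd : L * η * dnr d n ≤ 1 / 24) (hα0 : 0 ≤ α) (hα1 : α ≤ 1)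
    (hf : Integrable (fun ω => objective F ν
      (D.iterate F μr μc (fun _ => η) (fun _ => α) x₀ t ω)) P)
    (hG : Integrable (fun ω => ‖gradient (objective F ν)
      (D.iterate F μr μc (fun _ => η) (fun _ => α) x₀ t ω)‖ ^ 2) P) :
    Integrable (fun ω => objective F ν
      (D.iterate F μr μc (fun _ => η) (fun _ => α) x₀ (t + 1) ω)) P ∧
    Integrable (fun ω => ‖gradient (objective F ν)
      (D.iterate F μr μc (fun _ => η) (fun _ => α) x₀ (t + 1) ω)‖ ^ 2) P ∧
    ∫ ω, objective F ν (D.iterate F μr μc (fun _ => η) (fun _ => α) x₀ (t + 1) ω) ∂P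
      ≤ ∫ ω, objective F ν (D.iterate F μr μc (fun _ => η) (fun _ => α) x₀ t ω) ∂P
        - η / 4 * ∫ ω, ‖gradient (objective F ν)
          (D.iterate F μr μc (fun _ => η) (fun _ => α) x₀ t ω)‖ ^ 2 ∂P
        + (η / 2 * δ ^ 2 + L * η ^ 2 * (4 * α ^ 2 * dnr d n * (d * ζ ^ 2)
          + 5 / 2 * (1 - α) ^ 2 * ζ ^ 2 * ∫ ω, ∑ i, 1 / D.p t ω i ∂P)) := by
  set X := D.iterate F μr μc (fun _ => η) (fun _ => α) x₀ t with hXdef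
  have hX : Measurable[D.history t] X := hD.measurable_iterate hW _ _ _ _ _ ht.le
  have hX' : Measurable X := hX.mono (hD.history_le ht.le) le_rfl
  have hgm : Measurable (gradient (objective F ν)) :=
    (continuous_gradient_objective hW hF).measurable
  obtain ⟨hR, hR2⟩ := hD.integral_rge_sq_le hd hn hW hF hV hμr ht hX hG
  obtain ⟨hC, hC2⟩ := hD.integral_cge_sq_le hW hF hV hμc ht hX hG hc hp
  have hIR := hD.le_integral_inner_rge hd hn hW hF hV hμr ht hX hG
  have hIC := hD.le_integral_inner_cge hW hF hV hμc ht hX hG hc hp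
  have hRm : Measurable fun ω => rge F μr (X ω) (D.Br t ω) :=
    measurable_rge_comp hW μr hX' (hD.measurable_Br t ht)
  have hCm : Measurable fun ω => cge F μc (X ω) (D.I t ω) (D.p t ω) (D.Bc t ω) :=
    measurable_cge_comp hW μc hX' (hD.measurable_I t ht)
      ((hD.adapted_p t ht).mono (hD.afterRGE_le ht) le_rfl) (hD.measurable_Bc t ht)
  set R := fun ω => rge F μr (X ω) (D.Br t ω) with hRdef
  set C := fun ω => cge F μc (X ω) (D.I t ω) (D.p t ω) (D.Bc t ω) with hCdef
  have hHm : Measurable fun ω => α • R ω + (1 - α) • C ω :=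
    (hRm.const_smul α).add (hCm.const_smul (1 - α))
  have hIRi : Integrable (fun ω => ⟪gradient (objective F ν) (X ω), R ω⟫_ℝ) P :=
    integrable_inner_of_sq ((hgm.comp hX').inner hRm).aestronglyMeasurable hG hR
  have hICi : Integrable (fun ω => ⟪gradient (objective F ν) (X ω), C ω⟫_ℝ) P :=
    integrable_inner_of_sq ((hgm.comp hX').inner hCm).aestronglyMeasurable hG hC
  have hdom : Integrable (fun ω => 2 * α ^ 2 * ‖R ω‖ ^ 2 + 2 * (1 - α) ^ 2 * ‖C ω‖ ^ 2) P :=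
    (hR.const_mul _).add (hC.const_mul _)
  have hHle : ∀ ω, ‖α • R ω + (1 - α) • C ω‖ ^ 2
      ≤ 2 * α ^ 2 * ‖R ω‖ ^ 2 + 2 * (1 - α) ^ 2 * ‖C ω‖ ^ 2 := fun ω => by
    calc ‖α • R ω + (1 - α) • C ω‖ ^ 2 ≤ (‖α • R ω‖ + ‖(1 - α) • C ω‖) ^ 2 := by
          gcongr; exact norm_add_le _ _
      _ ≤ 2 * (‖α • R ω‖ ^ 2 + ‖(1 - α) • C ω‖ ^ 2) := add_sq_le
      _ = _ := by
          rw [norm_smul, norm_smul, mul_pow, mul_pow, Real.norm_eq_abs, Real.norm_eq_abs, sq_abs,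
            sq_abs]
          ring
  have hH2 : Integrable (fun ω => ‖α • R ω + (1 - α) • C ω‖ ^ 2) P :=
    hdom.mono' (hHm.norm.pow_const 2).aestronglyMeasurable (ae_of_all _ fun ω => by
      rw [Real.norm_of_nonneg (sq_nonneg _)]
      exact hHle ω)
  obtain ⟨h1, h2, h3⟩ := integral_objective_sub_smul_le hW hF hX' hHm η hf hG hH2
  refine ⟨h1, h2, h3.trans ?_⟩
  have hH2le := integral_mono hH2 hdom hHle
  rw [integral_add (hR.const_mul _) (hC.const_mul _), integral_const_mul,
    integral_const_mul] at hH2le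
  have hIH : ∫ ω, ⟪gradient (objective F ν) (X ω), α • R ω + (1 - α) • C ω⟫_ℝ ∂P
      = α * ∫ ω, ⟪gradient (objective F ν) (X ω), R ω⟫_ℝ ∂P
        + (1 - α) * ∫ ω, ⟪gradient (objective F ν) (X ω), C ω⟫_ℝ ∂P := by
    rw [← integral_const_mul, ← integral_const_mul,
      ← integral_add (hIRi.const_mul α) (hICi.const_mul (1 - α))]
    simp only [inner_add_right, real_inner_smul_right]
  rw [hIH]
  have hG0 : 0 ≤ ∫ ω, ‖gradient (objective F ν) (X ω)‖ ^ 2 ∂P :=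
    integral_nonneg fun _ => by positivity
  have hS0 : 0 ≤ ∫ ω, ∑ i, 1 / D.p t ω i ∂P := integral_nonneg_of_ae (hp.mono fun ω h =>
    Finset.sum_nonneg fun i _ => one_div_nonneg.2 (hc.le.trans (h i)))
  rw [hδr] at hR2 hIR
  exact descent_step_bound hd hL.le hη hc hα0 hα1 hG0 hS0 hηc hηd hδc hδ hR2 hC2 hIR hIC hH2le

end Descent

/-! ### The random output -/

section Output

variable {d n T : ℕ} {Ξ Ω : Type*} [MeasurableSpace Ξ] [mΩ : MeasurableSpace Ω]
  {F : Vec d → Ξ → ℝ} {ν : Measure Ξ} {P : Measure Ω} [IsProbabilityMeasure P]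
  {D : Draws d Ξ Ω n} {x₀ : Vec d}

/-- Averaging over the output index, which is uniform on `{1, …, T}` and independent of the run. -/
theorem Draws.IsZOHGD.integral_output (hD : D.IsZOHGD ν P T) (hT : 1 ≤ T) (hW : WellPosed F ν)
    (μr μc : ℝ) (η α : ℕ → ℝ) {ψ : Vec d → ℝ} (hψ : Measurable ψ)
    (hi : ∀ t ≤ T, Integrable (fun ω => ψ (D.iterate F μr μc η α x₀ t ω)) P) :
    Integrable (fun ω => ψ (D.output F μr μc η α x₀ ω)) P ∧
    ∫ ω, ψ (D.output F μr μc η α x₀ ω) ∂P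
      = (T : ℝ)⁻¹ * ∑ t ∈ Finset.Icc 1 T, ∫ ω, ψ (D.iterate F μr μc η α x₀ t ω) ∂P := by
  have hτm : ∀ t, MeasurableSet (D.τ ⁻¹' {t}) := fun t => hD.measurable_τ (measurableSet_singleton t)
  have hτ : ∀ᵐ ω ∂P, D.τ ω ∈ Finset.Icc 1 T := by
    have h : P (D.τ ⁻¹' (Finset.Icc 1 T : Finset ℕ)) = 1 := by
      rw [← sum_measure_preimage_singleton _ fun t _ => hτm t]
      rw [Finset.sum_congr rfl fun t ht => hD.law_τ t (Finset.mem_Icc.1 ht).1 (Finset.mem_Icc.1 ht).2]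
      rw [Finset.sum_const, Nat.card_Icc, Nat.add_sub_cancel, nsmul_eq_mul]
      exact ENNReal.mul_inv_cancel (by simpa using Nat.one_le_iff_ne_zero.1 hT)
        (ENNReal.natCast_ne_top T)
    exact (mem_ae_iff_prob_eq_one (hD.measurable_τ (Finset.measurableSet _))).2 h
  have hae : (fun ω => ψ (D.output F μr μc η α x₀ ω)) =ᵐ[P] fun ω =>
      ∑ t ∈ Finset.Icc 1 T, (D.τ ⁻¹' {t}).indicator (fun _ => (1 : ℝ)) ω
        * ψ (D.iterate F μr μc η α x₀ t ω) := hτ.mono fun ω hω => by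
    simp only [Draws.output]
    rw [Finset.sum_eq_single_of_mem (D.τ ω) hω fun t _ ht => by
      rw [Set.indicator_of_notMem (by simpa using ht.symm), zero_mul]]
    simp
  have hind : ∀ t ∈ Finset.Icc 1 T, IndepFun ((D.τ ⁻¹' {t}).indicator (fun _ => (1 : ℝ)))
      (fun ω => ψ (D.iterate F μr μc η α x₀ t ω)) P := fun t ht => by
    rw [IndepFun_iff_Indep]
    refine indep_of_indep_of_le_left (indep_of_indep_of_le_right hD.indep_τ ?_) ?_
    · exact (hψ.comp ((hD.measurable_iterate hW μr μc η α x₀ (Finset.mem_Icc.1 ht).2).mono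
        (Draws.history_mono (Finset.mem_Icc.1 ht).2) le_rfl)).comap_le
    · refine Measurable.comap_le (Measurable.indicator measurable_const ?_)
      exact ⟨{t}, trivial, rfl⟩
  have h1i : ∀ t, Integrable ((D.τ ⁻¹' {t}).indicator (fun _ => (1 : ℝ))) P := fun t =>
    (integrable_const _).indicator (hτm t)
  have hprod : ∀ t ∈ Finset.Icc 1 T, Integrable (fun ω =>
      (D.τ ⁻¹' {t}).indicator (fun _ => (1 : ℝ)) ω * ψ (D.iterate F μr μc η α x₀ t ω)) P :=
    fun t ht => (hind t ht).integrable_mul (h1i t) (hi t (Finset.mem_Icc.1 ht).2)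
  refine ⟨(integrable_finsetSum _ hprod).congr hae.symm, ?_⟩
  rw [integral_congr_ae hae, integral_finsetSum _ hprod, Finset.mul_sum]
  refine Finset.sum_congr rfl fun t ht => ?_
  rw [(hind t ht).integral_fun_mul_eq_mul_integral (h1i t).aestronglyMeasurable
    (hi t (Finset.mem_Icc.1 ht).2).aestronglyMeasurable, integral_indicator_const _ (hτm t),
    measureReal_def, hD.law_τ t (Finset.mem_Icc.1 ht).1 (Finset.mem_Icc.1 ht).2]
  simp

end Output

/-! ### Summation over the steps and choice of the parameters -/

section MeanInverseProbability

variable {d n T : ℕ} {Ξ Ω : Type*} [MeasurableSpace Ξ] [MeasurableSpace Ω] {ν : Measure Ξ}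
  {P : Measure Ω} [IsProbabilityMeasure P] {D : Draws d Ξ Ω n} {c : ℕ → ℝ}

theorem Draws.IsZOHGD.Pbar_eq (hD : D.IsZOHGD ν P T)
    (hc : ∀ t < T, 0 < c t ∧ ∀ᵐ ω ∂P, ∀ i, c t ≤ D.p t ω i) :
    D.Pbar P T = 1 / (d * T) * ∑ t ∈ Finset.range T, ∫ ω, ∑ i, 1 / D.p t ω i ∂P := by
  rw [Draws.Pbar, integral_const_mul, integral_finsetSum]
  intro t ht
  have ht := Finset.mem_range.1 ht
  exact integrable_sum_one_div (hc t ht).1 (hc t ht).2 fun i =>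
    (measurable_pi_apply i).comp ((hD.adapted_p t ht).mono (hD.afterRGE_le ht) le_rfl)

theorem Draws.IsZOHGD.Pbar_pos (hD : D.IsZOHGD ν P T) (hd : 1 ≤ d) (hT : 1 ≤ T)
    (hc : ∀ t < T, 0 < c t ∧ ∀ᵐ ω ∂P, ∀ i, c t ≤ D.p t ω i) : 0 < D.Pbar P T := by
  rw [hD.Pbar_eq hc]
  have hd0 : (0 : ℝ) < d := by exact_mod_cast hd
  have hT0 : (0 : ℝ) < T := by exact_mod_cast hT
  refine mul_pos (by positivity) (Finset.sum_pos (fun t ht => ?_) ⟨0, Finset.mem_range.2 hT⟩)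
  have ht := Finset.mem_range.1 ht
  have hpos : ∀ᵐ ω ∂P, 0 < ∑ i, 1 / D.p t ω i := (hc t ht).2.mono fun ω h =>
    Finset.sum_pos (fun i _ => one_div_pos.2 ((hc t ht).1.trans_le (h i)))
      ⟨⟨0, hd⟩, Finset.mem_univ _⟩
  have hnn : 0 ≤ᵐ[P] fun ω => ∑ i, 1 / D.p t ω i := hpos.mono fun ω h => h.le
  refine lt_of_le_of_ne (integral_nonneg_of_ae hnn) fun h0 => ?_
  have hi := integrable_sum_one_div (hc t ht).1 (hc t ht).2 fun i =>
    (measurable_pi_apply i).comp ((hD.adapted_p t ht).mono (hD.afterRGE_le ht) le_rfl)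
  obtain ⟨ω, hω1, hω2⟩ := (((integral_eq_zero_iff_of_nonneg_ae hnn hi).1 h0.symm).and hpos).exists
  exact hω2.ne' hω1

end MeanInverseProbability

section Rate

variable {d n T : ℕ} {Ξ Ω : Type*} [MeasurableSpace Ξ] [mΩ : MeasurableSpace Ω]
  {F : Vec d → Ξ → ℝ} {ν : Measure Ξ} [IsProbabilityMeasure ν] {P : Measure Ω}
  [IsProbabilityMeasure P] {L ζ δ μr μc η α : ℝ} {x₀ : Vec d} {D : Draws d Ξ Ω n} {c : ℕ → ℝ}

/-- The one-step bounds summed over the first `t` steps, together with the integrability that each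
step needs from the previous one. -/
theorem Draws.IsZOHGD.integral_objective_iterate_le (hD : D.IsZOHGD ν P T) (hd : 1 ≤ d)
    (hn : 1 ≤ n) (hL : 0 < L) (hW : WellPosed F ν) (hF : LipschitzGrad F L)
    (hV : CoordVarianceBound F ν ζ) (hμr : 0 < μr) (hμc : 0 < μc) (hδr : d * L * μr / 2 = δ)
    (hδc : d * (L * μc) ^ 2 = δ ^ 2) (hδ : δ ^ 2 ≤ d * ζ ^ 2)
    (hc : ∀ t < T, 0 < c t ∧ ∀ᵐ ω ∂P, ∀ i, c t ≤ D.p t ω i) (hη : 0 ≤ η)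
    (hηc : ∀ t < T, L * η ≤ c t / 8) (hηd : L * η * dnr d n ≤ 1 / 24) (hα0 : 0 ≤ α) (hα1 : α ≤ 1)
    {t : ℕ} (ht : t ≤ T) :
    Integrable (fun ω => objective F ν
      (D.iterate F μr μc (fun _ => η) (fun _ => α) x₀ t ω)) P ∧
    Integrable (fun ω => ‖gradient (objective F ν)
      (D.iterate F μr μc (fun _ => η) (fun _ => α) x₀ t ω)‖ ^ 2) P ∧
    ∫ ω, objective F ν (D.iterate F μr μc (fun _ => η) (fun _ => α) x₀ t ω) ∂P
      ≤ objective F ν x₀ - η / 4 * ∑ s ∈ Finset.range t, ∫ ω, ‖gradient (objective F ν)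
          (D.iterate F μr μc (fun _ => η) (fun _ => α) x₀ s ω)‖ ^ 2 ∂P
        + (t * (η / 2 * δ ^ 2) + L * η ^ 2 * (t * (4 * α ^ 2 * dnr d n * (d * ζ ^ 2))
          + 5 / 2 * (1 - α) ^ 2 * ζ ^ 2
            * ∑ s ∈ Finset.range t, ∫ ω, ∑ i, 1 / D.p s ω i ∂P)) := by
  induction t with
  | zero => simp [Draws.iterate]
  | succ t ih =>
    obtain ⟨h1, h2, h3⟩ := ih (Nat.le_of_succ_le ht)
    obtain ⟨h4, h5, h6⟩ := hD.integral_objective_iterate_succ_le hd hn hL hW hF hV hμr hμc hδr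
      hδc hδ ht (hc t ht).1 (hc t ht).2 hη (hηc t ht) hηd hα0 hα1 h1 h2
    refine ⟨h4, h5, h6.trans ?_⟩
    rw [Finset.sum_range_succ, Finset.sum_range_succ]
    push_cast
    linarith

/-- With `α = (1 + D / p)⁻¹` the two variance terms add up to `α D`. -/
theorem variance_weights {D p α : ℝ} (hD : 0 < D) (hp : 0 < p) (hα : α = (1 + D / p)⁻¹) :
    0 < α ∧ α ≤ 1 ∧ 4 * α ^ 2 * D + 5 / 2 * (1 - α) ^ 2 * p ≤ 4 * (D * α) := by
  have h1 : α = p / (p + D) := by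
    rw [hα]
    field_simp
  have h0 : 0 < α := by rw [h1]; positivity
  have h2 : α ≤ 1 := by
    rw [h1, div_le_one (by positivity)]
    linarith
  have h3 : (1 - α) * p = α * D := by
    rw [h1]
    field_simp
    ring
  refine ⟨h0, h2, ?_⟩
  have h4 : 5 / 2 * (1 - α) ^ 2 * p = 5 / 2 * (1 - α) * (α * D) := by rw [← h3]; ring
  have h5 : 0 ≤ (1 - α) * (α * D) := mul_nonneg (sub_nonneg.2 h2) (by positivity)
  have h6 : 4 * α ^ 2 * D = 4 * (D * α) - 4 * ((1 - α) * (α * D)) := by ring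
  linarith

/-- The bound on the average of the squared gradients of `x_1, …, x_T` in terms of `Q = √(R / T)`,
where `r = √(R T)`; `G` is the sum over `x_0, …, x_{T-1}` and `GT` belongs to `x_T`.
In the application `κ = L² K²` and `V` is the sum of the variance weights. -/
theorem rate_bound {L Δ a b T η δ σ κ R r Q V G GT E f₀ m : ℝ} (hL : 0 < L) (ha : 0 < a)
    (hT : 0 < T) (hR : 0 < R) (hr : 0 < r) (hrT : r = T * Q) (hrQ : r * Q = R)
    (hη1 : a * r⁻¹ ≤ η) (hη2 : η ≤ b * r⁻¹) (hηL : L * η ≤ 1 / 24) (hδ : δ ^ 2 ≤ κ * Q)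
    (hΔ : f₀ - m ≤ Δ) (hmf : m ≤ f₀) (hV : V ≤ 4 * R) (hG : 0 ≤ G)
    (hm : m ≤ E) (hGT : GT ≤ 2 * L * (E - m))
    (hE : E ≤ f₀ - η / 4 * G + (T * (η / 2 * δ ^ 2) + L * η ^ 2 * (T * (σ ^ 2 * V)))) :
    T⁻¹ * (G + GT) ≤ (4 * Δ / a + 3 * κ + 17 * L * σ ^ 2 * b + Δ / (12 * a)) * Q := by
  have hη : 0 < η := lt_of_lt_of_le (by positivity) hη1
  have hQ : 0 < Q := by
    rcases lt_or_ge 0 Q with h | h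
    · exact h
    · nlinarith
  have hΔ0 : 0 ≤ Δ := by linarith
  have hV' : L * η ^ 2 * (T * (σ ^ 2 * V)) ≤ L * η ^ 2 * (T * (σ ^ 2 * (4 * R))) := by gcongr
  -- `Q` bounds `1 / (η T)` and `1 / T` since `η` is at least `a / r`, and `η R` since `η ≤ b / r`.
  have h1 : (η * T)⁻¹ ≤ Q / a := by
    rw [← div_eq_mul_inv, div_le_iff₀ hr] at hη1
    rw [inv_le_comm₀ (by positivity) (by positivity), inv_div, div_le_iff₀ hQ]
    rw [hrT] at hη1
    linarith
  have h2 : η * R ≤ b * Q := by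
    rw [← div_eq_mul_inv, le_div_iff₀ hr] at hη2
    calc η * R = η * r * Q := by rw [← hrQ]; ring
      _ ≤ b * Q := by gcongr
  have h3 : L * T⁻¹ ≤ Q / (24 * a) := by
    have h4 : L * T⁻¹ = L * η * (η * T)⁻¹ := by field_simp
    rw [h4]
    calc L * η * (η * T)⁻¹ ≤ 1 / 24 * (Q / a) := by gcongr
      _ = Q / (24 * a) := by field_simp
  have hN : 0 ≤ L * σ ^ 2 * (η * R) := by positivity
  have hN2 : L * σ ^ 2 * (η * R) ≤ L * σ ^ 2 * (b * Q) := by gcongr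
  -- The iterates `x_0, …, x_{T-1}`, whose gradients the descent inequality bounds.
  have h5 : T⁻¹ * G ≤ 4 * Δ * (η * T)⁻¹ + 2 * δ ^ 2 + 16 * (L * σ ^ 2 * (η * R)) := by
    have h6 : η / 4 * G ≤ Δ + T * (η / 2 * δ ^ 2) + L * η ^ 2 * (T * (σ ^ 2 * (4 * R))) := by
      linarith
    have h7 : T⁻¹ * G = 4 * (η * T)⁻¹ * (η / 4 * G) := by field_simp
    rw [h7]
    calc 4 * (η * T)⁻¹ * (η / 4 * G) ≤ 4 * (η * T)⁻¹
          * (Δ + T * (η / 2 * δ ^ 2) + L * η ^ 2 * (T * (σ ^ 2 * (4 * R)))) := by gcongr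
      _ = _ := by
        field_simp
        ring
  -- The iterate `x_T`, through the bound on `E f(x_T) - inf f`.
  have h8 : T⁻¹ * GT ≤ 2 * Δ * (L * T⁻¹) + δ ^ 2 + L * σ ^ 2 * (η * R) := by
    have h6 : GT ≤ 2 * L * (Δ + T * (η / 2 * δ ^ 2) + L * η ^ 2 * (T * (σ ^ 2 * (4 * R)))) := by
      refine hGT.trans ?_
      gcongr
      linarith [mul_nonneg hη.le hG]
    calc T⁻¹ * GT ≤ T⁻¹ * (2 * L * (Δ + T * (η / 2 * δ ^ 2)
          + L * η ^ 2 * (T * (σ ^ 2 * (4 * R))))) := by gcongr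
      _ = 2 * Δ * (L * T⁻¹) + L * η * δ ^ 2 + 8 * (L * η) * (L * σ ^ 2 * (η * R)) := by
        field_simp
        ring
      _ ≤ 2 * Δ * (L * T⁻¹) + 1 / 24 * δ ^ 2 + 8 * (1 / 24) * (L * σ ^ 2 * (η * R)) := by gcongr
      _ ≤ _ := by linarith [sq_nonneg δ]
  calc T⁻¹ * (G + GT) = T⁻¹ * G + T⁻¹ * GT := by ring
    _ ≤ _ := by
      have h9 : 4 * Δ * (η * T)⁻¹ ≤ 4 * Δ * (Q / a) := by gcongr
      have h10 : 2 * Δ * (L * T⁻¹) ≤ 2 * Δ * (Q / (24 * a)) := by gcongr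
      have h11 : (4 * Δ / a + 3 * κ + 17 * L * σ ^ 2 * b + Δ / (12 * a)) * Q
        = 4 * Δ * (Q / a) + 3 * (κ * Q) + 17 * (L * σ ^ 2 * (b * Q)) + 2 * Δ * (Q / (24 * a)) := by
        field_simp
        ring
      linarith

/-- The largest smoothing radius that is allowed, squared and multiplied by the dimension. -/
theorem smoothing_radius_sq {d T A w : ℝ} (hd : 0 < d) (hT : 0 < T) (hA : 0 < A) (hw : 0 < w) :
    d * ((A / (d ^ 2 * T)) ^ (1 / 4 : ℝ) * w ^ (-(1 / 4) : ℝ)) ^ 2 = √(A / T * (1 / w)) := by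
  have h4 : ∀ {y : ℝ}, 0 ≤ y → ∀ s : ℝ, (y ^ s) ^ 4 = y ^ (s * 4) := fun hy s => by
    rw [← Real.rpow_natCast, ← Real.rpow_mul hy]
    norm_num
  symm
  rw [Real.sqrt_eq_iff_mul_self_eq (by positivity) (by positivity)]
  set y := (A / (d ^ 2 * T)) ^ (1 / 4 : ℝ) with hy
  set z := w ^ (-(1 / 4) : ℝ) with hz
  have hy4 : y ^ 4 = A / (d ^ 2 * T) := by
    rw [hy, h4 (by positivity)]
    norm_num
  have hz4 : z ^ 4 = w⁻¹ := by
    rw [hz, h4 hw.le]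
    norm_num [Real.rpow_neg_one]
  symm
  calc d * (y * z) ^ 2 * (d * (y * z) ^ 2) = d ^ 2 * y ^ 4 * z ^ 4 := by ring
    _ = A / T * (1 / w) := by
      rw [hy4, hz4]
      field_simp

end Rate

end ZOHGD

theorem theorem1 (L σ Δ K a b : ℝ) (hL : 0 < L) (hσ : 0 < σ) (ha : 0 < a) :
    ∃ C : ℝ,
      ∀ (d n T : ℕ), 1 ≤ d → 1 ≤ n → 1 ≤ T →
      ∀ (Ξ : Type*) [MeasurableSpace Ξ] (ν : Measure Ξ) [IsProbabilityMeasure ν]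
        (F : ZOHGD.Vec d → Ξ → ℝ) (ζ : ℝ) (x₀ : ZOHGD.Vec d),
      ZOHGD.WellPosed F ν →
      ZOHGD.LipschitzGrad F L →
      ZOHGD.CoordVarianceBound F ν ζ →
      σ ^ 2 = d * ζ ^ 2 →
      BddBelow (Set.range (ZOHGD.objective F ν)) →
      ZOHGD.objective F ν x₀ - ⨅ y, ZOHGD.objective F ν y ≤ Δ →
      ∀ (Ω : Type*) [MeasurableSpace Ω] (P : Measure Ω) [IsProbabilityMeasure P]
        (D : ZOHGD.Draws d Ξ Ω n), D.IsZOHGD ν P T →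
      ∀ (c : ℕ → ℝ) (μr μc η α : ℝ),
      (∀ t < T, 0 < c t ∧ ∀ᵐ ω ∂P, ∀ i, c t ≤ D.p t ω i) →
      0 < μr →
      μc = μr * √d / 2 →
      μc * L * √d ≤ σ →
      μc ≤ K * ((ZOHGD.dnr d n / ((d : ℝ) ^ 2 * T)) ^ (1 / 4 : ℝ) *
        (1 + ZOHGD.dnr d n / D.Pbar P T) ^ (-(1 / 4) : ℝ)) →
      (∀ t < T, η ≤ 1 / (24 * L) * min (3 * c t) (1 / ZOHGD.dnr d n)) →
      a * (√(ZOHGD.dnr d n * T * (1 / (1 + ZOHGD.dnr d n / D.Pbar P T))))⁻¹ ≤ η →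
      η ≤ b * (√(ZOHGD.dnr d n * T * (1 / (1 + ZOHGD.dnr d n / D.Pbar P T))))⁻¹ →
      α = (1 + ZOHGD.dnr d n / D.Pbar P T)⁻¹ →
      Integrable (fun ω => ‖gradient (ZOHGD.objective F ν)
        (D.output F μr μc (fun _ => η) (fun _ => α) x₀ ω)‖ ^ 2) P ∧
      ∫ ω, ‖gradient (ZOHGD.objective F ν)
          (D.output F μr μc (fun _ => η) (fun _ => α) x₀ ω)‖ ^ 2 ∂P
        ≤ C * √(ZOHGD.dnr d n / T * (1 / (1 + ZOHGD.dnr d n / D.Pbar P T))) := by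
  refine ⟨4 * Δ / a + 3 * (L ^ 2 * K ^ 2) + 17 * L * σ ^ 2 * b + Δ / (12 * a), ?_⟩
  intro d n T hd hn hT Ξ _ ν _ F ζ x₀ hW hF hV hσζ hbdd hΔ Ω _ P _ D hD c μr μc η α hc hμr hμc hμσ
    hμK hη hη1 hη2 hα
  have hd0 : (0 : ℝ) < d := by exact_mod_cast hd
  have hT0 : (0 : ℝ) < T := by exact_mod_cast hT
  have hdnr : 1 ≤ ZOHGD.dnr d n := by
    rw [ZOHGD.dnr]
    linarith [show (0 : ℝ) ≤ d / n by positivity]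
  have hA : 0 < ZOHGD.dnr d n := by linarith
  have hPb := hD.Pbar_pos hd hT hc
  have hPe := hD.Pbar_eq hc
  have hsqd : √(d : ℝ) ^ 2 = d := Real.sq_sqrt hd0.le
  have hμc0 : 0 < μc := by rw [hμc]; positivity
  obtain ⟨hα0, hα1, hweights⟩ := ZOHGD.variance_weights hA hPb hα
  have hw : 1 / (1 + ZOHGD.dnr d n / D.Pbar P T) = α := by rw [hα, one_div]
  have hrad := ZOHGD.smoothing_radius_sq hd0 hT0 hA
    (show 0 < 1 + ZOHGD.dnr d n / D.Pbar P T by positivity)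
  rw [hw] at hη1 hη2 hrad ⊢
  set A := ZOHGD.dnr d n with hAdef
  set Q := √(A / T * α) with hQ
  set r := √(A * T * α) with hr
  have hr0 : 0 < r := Real.sqrt_pos.2 (by positivity)
  have hQ0 : 0 < Q := Real.sqrt_pos.2 (by positivity)
  have hQ2 : Q ^ 2 = A / T * α := Real.sq_sqrt (by positivity)
  have hrT : r = T * Q := by
    rw [hr, Real.sqrt_eq_iff_mul_self_eq (by positivity) (by positivity)]
    symm
    calc T * Q * (T * Q) = T ^ 2 * Q ^ 2 := by ring
      _ = A * T * α := by rw [hQ2]; field_simp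
  have hrQ : r * Q = A * α := by
    calc r * Q = T * Q ^ 2 := by rw [hrT]; ring
      _ = A * α := by rw [hQ2]; field_simp
  have hη0 : 0 < η := lt_of_lt_of_le (by positivity) hη1
  have hηc : ∀ t < T, L * η ≤ c t / 8 := fun t ht => by
    have h := (hη t ht).trans (mul_le_mul_of_nonneg_left (min_le_left _ _) (by positivity))
    calc L * η ≤ L * (1 / (24 * L) * (3 * c t)) := by gcongr
      _ = c t / 8 := by
        field_simp
        ring
  have hηA : L * η * A ≤ 1 / 24 := by
    have h := (hη 0 hT).trans (mul_le_mul_of_nonneg_left (min_le_right _ _) (by positivity))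
    calc L * η * A ≤ L * (1 / (24 * L) * (1 / A)) * A := by gcongr
      _ = 1 / 24 := by field_simp
  have hηL : L * η ≤ 1 / 24 := (le_mul_of_one_le_right (by positivity) hdnr).trans hηA
  -- Since `μc = μr √d / 2`, both estimators have bias at most `δ = μc L √d`.
  have hδc : d * (L * μc) ^ 2 = (μc * L * √d) ^ 2 := by
    rw [mul_pow (μc * L), hsqd]
    ring
  have hδr : d * L * μr / 2 = μc * L * √d := by
    rw [hμc]
    nth_rewrite 1 [← hsqd]
    ring
  have hδ : (μc * L * √d) ^ 2 ≤ d * ζ ^ 2 := by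
    rw [← hσζ]
    exact pow_le_pow_left₀ (by positivity) hμσ 2
  have hδQ : (μc * L * √d) ^ 2 ≤ L ^ 2 * K ^ 2 * Q := by
    have h := pow_le_pow_left₀ hμc0.le hμK 2
    rw [← hδc, ← hrad]
    calc d * (L * μc) ^ 2 = d * L ^ 2 * μc ^ 2 := by ring
      _ ≤ d * L ^ 2 * (K * ((A / ((d : ℝ) ^ 2 * T)) ^ (1 / 4 : ℝ) *
          (1 + A / D.Pbar P T) ^ (-(1 / 4) : ℝ))) ^ 2 := by gcongr
      _ = _ := by ring
  have hrun := fun t (ht : t ≤ T) => hD.integral_objective_iterate_le (x₀ := x₀) hd hn hL hW hF hV hμr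
    hμc0 hδr hδc hδ hc hη0.le hηc hηA hα0.le hα1 ht
  have hgm : Measurable fun x => ‖gradient (ZOHGD.objective F ν) x‖ ^ 2 :=
    ((ZOHGD.continuous_gradient_objective hW hF).norm.pow 2).measurable
  have hout := hD.integral_output (x₀ := x₀) hT hW μr μc (fun _ => η) (fun _ => α) hgm
    fun t ht => (hrun t ht).2.1
  refine ⟨hout.1, ?_⟩
  rw [hout.2]
  obtain ⟨hfi, hgi, hE⟩ := hrun T le_rfl
  have hlow : ∀ y, ⨅ y, ZOHGD.objective F ν y ≤ ZOHGD.objective F ν y := fun y => ciInf_le hbdd y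
  have hm : ⨅ y, ZOHGD.objective F ν y ≤ ∫ ω, ZOHGD.objective F ν
      (D.iterate F μr μc (fun _ => η) (fun _ => α) x₀ T ω) ∂P := by
    have := integral_mono (integrable_const _) hfi fun ω => hlow
      (D.iterate F μr μc (fun _ => η) (fun _ => α) x₀ T ω)
    simpa using this
  have hGT : ∫ ω, ‖gradient (ZOHGD.objective F ν)
      (D.iterate F μr μc (fun _ => η) (fun _ => α) x₀ T ω)‖ ^ 2 ∂P
      ≤ 2 * L * (∫ ω, ZOHGD.objective F ν
        (D.iterate F μr μc (fun _ => η) (fun _ => α) x₀ T ω) ∂P - ⨅ y, ZOHGD.objective F ν y) := by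
    have := integral_mono hgi ((hfi.sub (integrable_const (⨅ y, ZOHGD.objective F ν y))).const_mul
      (2 * L)) fun ω => ZOHGD.norm_gradient_sq_le hL (ZOHGD.differentiable_objective hW hF)
        (ZOHGD.lipschitz_gradient_objective hW hF) hlow
        (D.iterate F μr μc (fun _ => η) (fun _ => α) x₀ T ω)
    rw [integral_const_mul, integral_sub' hfi (integrable_const _)] at this
    simpa using this
  set Gt := fun t => ∫ ω, ‖gradient (ZOHGD.objective F ν)
    (D.iterate F μr μc (fun _ => η) (fun _ => α) x₀ t ω)‖ ^ 2 ∂P with hGt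
  have hsum : ∑ t ∈ Finset.Icc 1 T, Gt t ≤ ∑ t ∈ Finset.range T, Gt t + Gt T := by
    rw [← Finset.sum_range_succ, Finset.range_eq_Ico]
    refine Finset.sum_le_sum_of_subset_of_nonneg (fun t ht => ?_) fun t _ _ =>
      integral_nonneg fun _ => by positivity
    simp only [Finset.mem_Icc, Finset.mem_Ico] at ht ⊢
    omega
  have hvar : T * (4 * α ^ 2 * A * (d * ζ ^ 2)) + 5 / 2 * (1 - α) ^ 2 * ζ ^ 2
      * ∑ s ∈ Finset.range T, ∫ ω, ∑ i, 1 / D.p s ω i ∂P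
      = T * (σ ^ 2 * (4 * α ^ 2 * A + 5 / 2 * (1 - α) ^ 2 * D.Pbar P T)) := by
    rw [hσζ, hPe]
    field_simp
  rw [hvar] at hE
  calc (T : ℝ)⁻¹ * ∑ t ∈ Finset.Icc 1 T, Gt t
      ≤ (T : ℝ)⁻¹ * (∑ t ∈ Finset.range T, Gt t + Gt T) := by gcongr
    _ ≤ _ := ZOHGD.rate_bound hL ha hT0 (by positivity) hr0 hrT hrQ hη1 hη2 hηL hδQ hΔ (hlow x₀)
        hweights (Finset.sum_nonneg fun _ _ => integral_nonneg fun _ => by positivity) hm hGT hE
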